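/- **Setting.** There are countably many arms $a=1,2,\dots$. Their ranks $\gamma(a)$ are independent and uniform on $[0,1]$, and the $s$-th pull of arm $a$ yields the reward $X_{a,s}=\lambda_{\gamma(a)}+\varepsilon_{a,s}$, where $\lambda_\eta=\eta^{-\alpha}$ with $\alpha>0$ (Pareto reservoir) and, for each arm $a$, the noise variables $(\varepsilon_{a,s})_{s\ge1}$ are independent, centered and $\zeta^2$-sub-Gaussian with $\zeta>0$, i.e. $\mathbb E[e^{\theta\varepsilon_{a,s}}]\le e^{\zeta^2\theta^2/2}$ for all $\theta\in\mathbb R$. Fix $\delta\in(0,1)$ and put $\beta_t=6\log(5t/\delta)$. **Algorithm (OSE).** Let $N_{a,t}$ be the number of pulls of arm $a$ up to time $t$, $\overline X_{a,t}$ the average of the $N_{a,t}$ rewards obtained from it, $\mathrm{UCB}_{a,t}=\overline X_{a,t}+\sqrt{\zeta^2\beta_t/N_{a,t}}$ and $\mathrm{LCB}_{a,t}=\overline X_{a,t}-\sqrt{\zeta^2\beta_t/N_{a,t}}$, with the conventions $\mathrm{UCB}_{a,t}=+\infty$ and $\mathrm{LCB}_{a,t}=-\infty$ if $N_{a,t}=0$.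 Let $(U_t)_{t\ge1}$ be independent and uniform on $[0,1]$. At each time $t=1,2,\dots$ the algorithm pulls an arm $\hat a_t\in\operatorname{argmax}_{a\le\lfloor t^{U_t}\rfloor}\mathrm{UCB}_{a,t-1}$ and recommends an arm $\hat r_t\in\operatorname{argmax}_{a\ge1}\mathrm{LCB}_{a,t}$ (ties are broken arbitrarily). No independence between the three families $(\gamma(a))$, $(\varepsilon_{a,s})$, $(U_t)$, nor between the noises of different arms, is required. **Rank.** For $0<\rho<\nu\le1$ let $$G(\rho,\nu)=\frac{\zeta^2\nu}{\rho(\lambda_\rho-\lambda_\nu)^2}\vee\frac1\rho,\qquad \tilde S(\eta)=\sup_{2\eta\le\nu\le1}G(\eta,\nu),\qquad \tilde\eta_t(\psi)=2\inf\{\eta\in(0,\tfrac12):\tilde S(\eta)\le t/\psi\},$$ where the infimum of the empty set is $\tfrac12$ (so that then $\tilde\eta_t(\psi)=1$, the trivial rank). Let $\psi=\psi_{t,\delta}$, $t\ge1$, be any numbers with $\psi_{t,\delta}\ge2^{30}\log^3(5t/\delta)$. **Claim.** 1. For all $t\ge1$, with $\mathbf t=t/(16\psi)$, $$\tfrac12\tilde\eta_t(\psi)\le\begin{cases}\dfrac\psi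 t\vee\Big(\dfrac{4\psi\zeta^2}{\alpha^2t}\Big)^{\frac1{1-2\alpha}}\le\dfrac1{\mathbf t}\vee\Big(\dfrac{\zeta^2}{\alpha^2\mathbf t}\Big)^{\frac1{1-2\alpha}}&\text{if }\alpha<\tfrac12,\\[2mm]\dfrac\psi t\vee\mathbf 1\{t<\psi(16\zeta^2)^{\frac1{2\alpha}}\}\le\dfrac1{\mathbf t}\vee\mathbf 1\{\mathbf t<(4\zeta^2)^{\frac1{2\alpha}}\}&\text{if }\alpha\ge\tfrac12.\end{cases}$$ 2. With probability at least $1-\delta$, the following holds simultaneously for all $t\ge1$: $\gamma(\hat r_t)\le\tilde\eta_t(\psi)$ and, with $\mathbf t=t/(32\psi)$, $$\lambda_{\gamma(\hat r_t)}\ge\begin{cases}\mathbf t^\alpha\wedge\Big(\dfrac{\alpha^2\mathbf t}{\zeta^2}\Big)^{\frac\alpha{1-2\alpha}}&\text{if }\alpha<\tfrac12,\\[2mm]\mathbf t^\alpha\,\mathbf 1\{\mathbf t\ge(4\zeta^2)^{\frac1{2\alpha}}\}&\text{if }\alpha\ge\tfrac12.\end{cases}$$ -/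

import Mathlib

open MeasureTheory ProbabilityTheory Set
open scoped ENNReal

noncomputable section

namespace ManyArmed

/-! ### Ranks and significance -/

/-- The quantile function of the Pareto reservoir, `η ↦ η ^ (-α)`. -/
def paretoQuantile (α η : ℝ) : ℝ := η ^ (-α)

/-- The rank-corrected inverse squared gap function
`G(ρ, ν) = ζ² ν / (ρ (lam ρ - lam ν)²) ∨ 1 / ρ`. It takes values in `[0, ∞]`, so that a vanishing
gap gives `∞`. -/
def gapFn (ζ : ℝ) (lam : ℝ → ℝ) (ρ ν : ℝ) : ℝ≥0∞ :=
  max (ENNReal.ofReal (ζ ^ 2 * ν) / ENNReal.ofReal (ρ * (lam ρ - lam ν) ^ 2))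
    (ENNReal.ofReal (1 / ρ))

/-- The relaxed sample complexity `S̃(η) = sup_{ν ≥ 2η} G(η, ν)`, the ranks `ν` being at most `1`. -/
def relaxedComplexity (ζ : ℝ) (lam : ℝ → ℝ) (η : ℝ) : ℝ≥0∞ :=
  ⨆ ν ∈ Icc (2 * η) 1, gapFn ζ lam η ν

/-- The rank `η̃_t(ψ) = 2 inf {η ∈ (0, 1/2) : S̃(η) ≤ t / ψ}`. The infimum is the one of subsets of
`(0, 1/2)`, so that it is `1/2` for the empty set, which gives the trivial rank `η̃_t(ψ) = 1`. -/
def relaxedRank (ζ : ℝ) (lam : ℝ → ℝ) (ψ : ℝ) (t : ℕ) : ℝ :=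
  2 * sInf (insert (1 / 2)
    {η | η ∈ Ioo (0 : ℝ) (1 / 2) ∧ relaxedComplexity ζ lam η ≤ ENNReal.ofReal (t / ψ)})

/-! ### The bandit model

Arms are indexed by `ℕ`, the index `a` standing for the `(a + 1)`-st arm. Times `t`, and the
samples of one arm, are numbered from `1`. -/

/-- The reward of the `s`-th pull of arm `a`, for given ranks and noise. -/
def reward (lam : ℝ → ℝ) (γ : ℕ → ℝ) (ε : ℕ → ℕ → ℝ) (a s : ℕ) : ℝ := lam (γ a) + ε a s

/-- The random inputs of the model: `γ a` is the rank of arm `a`, `ε a s` the noise of the `s`-th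
pull of arm `a`, and `U t` the draw of the algorithm at time `t`. The ranks are independent and
uniform on `[0, 1]`; for each arm the noise variables are independent, centered and
`ζ²`-sub-Gaussian; the draws are independent and uniform on `[0, 1]`. This includes the case where
all these variables are mutually independent. -/
structure IsBanditModel {Ω : Type*} [MeasurableSpace Ω] (μ : Measure Ω) (ζ : ℝ)
    (γ : ℕ → Ω → ℝ) (ε : ℕ → ℕ → Ω → ℝ) (U : ℕ → Ω → ℝ) : Prop where
  measurable_rank : ∀ a, Measurable (γ a)
  rank_uniform : ∀ a, pdf.IsUniform (γ a) (Icc 0 1) μ volume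
  rank_indep : iIndepFun γ μ
  measurable_noise : ∀ a, ∀ s ≥ 1, Measurable (ε a s)
  noise_centered : ∀ a, ∀ s ≥ 1, ∫ ω, ε a s ω ∂μ = 0
  noise_subGaussian : ∀ a, ∀ s ≥ 1, HasSubgaussianMGF (ε a s) (Real.toNNReal (ζ ^ 2)) μ
  noise_indep : ∀ a, iIndepFun (fun s : ℕ => ε a (s + 1)) μ
  measurable_draw : ∀ t ≥ 1, Measurable (U t)
  draw_uniform : ∀ t ≥ 1, pdf.IsUniform (U t) (Icc 0 1) μ volume
  draw_indep : iIndepFun (fun t : ℕ => U (t + 1)) μ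

/-! ### The algorithm OSE (Optimistic Scope Exploration)

Below, `X a s` is the reward of the `s`-th pull of arm `a`, and `pull t` is the arm pulled at
time `t`. -/

/-- The number of pulls of arm `a` up to time `t`. -/
def numPulls (pull : ℕ → ℕ) (a t : ℕ) : ℕ := ((Finset.Icc 1 t).filter (fun s => pull s = a)).card

/-- The empirical mean of the rewards obtained from arm `a` up to time `t`. -/
def empMean (X : ℕ → ℕ → ℝ) (pull : ℕ → ℕ) (a t : ℕ) : ℝ :=
  (∑ s ∈ Finset.Icc 1 (numPulls pull a t), X a s) / (numPulls pull a t : ℝ)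

/-- The upper confidence bound of arm `a` at time `t`, `+∞` for an arm that was not pulled. -/
def ucb (ζ : ℝ) (β : ℕ → ℝ) (X : ℕ → ℕ → ℝ) (pull : ℕ → ℕ) (a t : ℕ) : EReal :=
  if numPulls pull a t = 0 then ⊤
  else ((empMean X pull a t + √(ζ ^ 2 * β t / (numPulls pull a t : ℝ)) : ℝ) : EReal)

/-- The lower confidence bound of arm `a` at time `t`, `-∞` for an arm that was not pulled. -/
def lcb (ζ : ℝ) (β : ℕ → ℝ) (X : ℕ → ℕ → ℝ) (pull : ℕ → ℕ) (a t : ℕ) : EReal :=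
  if numPulls pull a t = 0 then ⊥
  else ((empMean X pull a t - √(ζ ^ 2 * β t / (numPulls pull a t : ℝ)) : ℝ) : EReal)

/-- The exploration scope `⌊t ^ u⌋`. -/
def scope (t : ℕ) (u : ℝ) : ℕ := ⌊(t : ℝ) ^ u⌋₊

/-- `pull` and `rec` are the pulled and the recommended arms of a run of OSE on the rewards `X` with
the draws `u`: at each time `t ≥ 1` an arm of largest UCB (at time `t - 1`) among the first
`⌊t ^ u_t⌋` arms is pulled, and an arm of largest LCB (at time `t`) among all arms is recommended.
Ties are broken arbitrarily. -/
structure IsOSERun (ζ : ℝ) (β : ℕ → ℝ) (X : ℕ → ℕ → ℝ) (u : ℕ → ℝ) (pull rec : ℕ → ℕ) :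
    Prop where
  pull_mem_scope : ∀ t ≥ 1, pull t < scope t (u t)
  pull_argmax : ∀ t ≥ 1, ∀ a < scope t (u t),
    ucb ζ β X pull a (t - 1) ≤ ucb ζ β X pull (pull t) (t - 1)
  rec_argmax : ∀ t ≥ 1, ∀ a, lcb ζ β X pull a t ≤ lcb ζ β X pull (rec t) t

end ManyArmed

end

/-! The rank bounds are deterministic: for `ν ≥ 2η` the gap of `η` to `ν` is at least `(1 - 2^(-α))
λ_η`, and `η λ_η² = η^(1-2α)`, so an explicit `η` can be tested in the definition of the rank.

For the algorithm, let `l = log (5t/δ)` and suppose that `S̃(η) ≤ c = t/ψ` while the recommended arm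
has rank above `2η`. Take a power of two `K` of order `l/η`. The first `K` arms then contain one of
rank at most `p = 6l/K`, where `η/2 ≤ p ≤ η`. The scope is log-uniform, so it lies in `[K, 2K]` at
more than `t/(16l)` of the times in `(t/2, t]`. At such a time optimism gives the pulled arm, of
rank `ν`, a UCB of at least `λ_η`. If `ν ≥ 2η`, its confidence interval must be wide; if `ν < 2η`,
it must be wide as well, since otherwise the LCB of this arm would beat the recommendation. So the
arm had at most order `c l √η min(1, √(p/ν))` pulls (`numPulls_le_of_rec_rank_gt`). As `1/√ν` is
integrable for uniform ranks, summing over `2K` arms leaves order `c l²` such times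
(`card_times_le_of_rec_rank_gt`), fewer than `t/(16l)` because `ψ ≥ 2^30 l³`. This contradiction is
`rec_rank_le`.

Of the supremum in `S̃` only `ν = 1` is used; `pareto_gap_lower` transfers it to the other ranks.
Each concentration event concerns a single family of variables, so a union bound
(`IsBanditModel.exists_good_event`) needs no independence between families. -/

namespace ManyArmed

/-! ### The rank for the Pareto reservoir -/

/-- Bernoulli's inequality for `(1 - 1/2)^α`, with exponent at most one. -/
theorem half_le_one_sub_two_rpow_neg {α : ℝ} (h0 : 0 ≤ α) (h1 : α ≤ 1) :
    α / 2 ≤ 1 - (2 : ℝ) ^ (-α) := by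
  have h := rpow_one_add_le_one_add_mul_self (s := -(1 / 2 : ℝ)) (by norm_num) h0 h1
  have e : (2 : ℝ) ^ (-α) = (1 + -(1 / 2 : ℝ)) ^ α := by
    rw [Real.rpow_neg (by norm_num), ← Real.inv_rpow (by norm_num)]
    norm_num
  rw [e]
  linarith

theorem quarter_le_one_sub_two_rpow_neg {α : ℝ} (h : 1 / 2 ≤ α) :
    1 / 4 ≤ 1 - (2 : ℝ) ^ (-α) := by
  have h1 := half_le_one_sub_two_rpow_neg (α := 1 / 2) (by norm_num) (by norm_num)
  have h2 : (2 : ℝ) ^ (-α) ≤ 2 ^ (-(1 / 2 : ℝ)) :=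
    Real.rpow_le_rpow_of_exponent_le (by norm_num) (by linarith)
  linarith

theorem paretoQuantile_anti {α x y : ℝ} (hα : 0 < α) (hx : 0 < x) (hxy : x ≤ y) :
    paretoQuantile α y ≤ paretoQuantile α x :=
  Real.rpow_le_rpow_of_nonpos hx hxy (by linarith)

theorem paretoQuantile_two_mul {α η : ℝ} (hη : 0 < η) :
    paretoQuantile α (2 * η) = 2 ^ (-α) * paretoQuantile α η :=
  Real.mul_rpow (by norm_num) hη.le

/-- The quantile function is decreasing, so the smallest gap over `ν ≥ 2η` is the one at `2η`,
namely `(1 - 2^(-α)) λ_η`; in the numerator `ν ≤ 1`. -/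
theorem relaxedComplexity_pareto_le {α ζ η κ c : ℝ} (hα : 0 < α) (hη : 0 < η) (hκ : 0 ≤ κ)
    (hκα : κ ≤ 1 - (2 : ℝ) ^ (-α)) (h1 : 1 / η ≤ c)
    (h2 : ζ ^ 2 ≤ c * η * (κ * paretoQuantile α η) ^ 2) :
    relaxedComplexity ζ (paretoQuantile α) η ≤ ENNReal.ofReal c := by
  have hc : 0 ≤ c := le_trans (by positivity) h1
  refine iSup₂_le fun ν hν => max_le ?_ (ENNReal.ofReal_le_ofReal h1)
  refine ENNReal.div_le_of_le_mul ?_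
  rw [← ENNReal.ofReal_mul hc]
  refine ENNReal.ofReal_le_ofReal ?_
  have hq : 0 ≤ paretoQuantile α η := Real.rpow_nonneg hη.le _
  have hgap : κ * paretoQuantile α η ≤ paretoQuantile α η - paretoQuantile α ν := by
    have := paretoQuantile_anti hα (by linarith) hν.1
    rw [paretoQuantile_two_mul hη] at this
    nlinarith
  calc ζ ^ 2 * ν ≤ ζ ^ 2 * 1 := by gcongr; exact hν.2
    _ = ζ ^ 2 := mul_one _
    _ ≤ c * η * (κ * paretoQuantile α η) ^ 2 := h2
    _ ≤ c * η * (paretoQuantile α η - paretoQuantile α ν) ^ 2 := by gcongr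
    _ = _ := by ring

/-- The value `1/2` inserted in the infimum settles every `m ≥ 1/2`, so only smaller `m` have to be
tested. -/
theorem relaxedRank_half_le {ζ ψ m : ℝ} {lam : ℝ → ℝ} {t : ℕ}
    (h : m < 1 / 2 → 0 < m ∧ relaxedComplexity ζ lam m ≤ ENNReal.ofReal (t / ψ)) :
    relaxedRank ζ lam ψ t / 2 ≤ m := by
  rw [relaxedRank, mul_div_cancel_left₀ _ two_ne_zero]
  have hbdd : BddBelow (insert (1 / 2) {η | η ∈ Ioo (0 : ℝ) (1 / 2) ∧
      relaxedComplexity ζ lam η ≤ ENNReal.ofReal (t / ψ)}) :=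
    ⟨0, by rintro x (rfl | hx); exacts [by norm_num, hx.1.1.le]⟩
  by_cases hm : m < 1 / 2
  · exact csInf_le hbdd (Or.inr ⟨⟨(h hm).1, hm⟩, (h hm).2⟩)
  · exact (csInf_le hbdd (Or.inl rfl)).trans (not_lt.1 hm)

theorem le_relaxedRank {ζ ψ x : ℝ} {lam : ℝ → ℝ} {t : ℕ} (hx : x ≤ 1)
    (h : ∀ η ∈ Ioo (0 : ℝ) (1 / 2), relaxedComplexity ζ lam η ≤ ENNReal.ofReal (t / ψ) →
      x ≤ 2 * η) :
    x ≤ relaxedRank ζ lam ψ t := by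
  have : x / 2 ≤ sInf (insert (1 / 2) {η | η ∈ Ioo (0 : ℝ) (1 / 2) ∧
      relaxedComplexity ζ lam η ≤ ENNReal.ofReal (t / ψ)}) := by
    refine le_csInf (insert_nonempty _ _) ?_
    rintro η (rfl | hη)
    · linarith
    · linarith [h η hη.1 hη.2]
  rw [relaxedRank]
  linarith

theorem relaxedRank_pareto_le_of_lt {α ζ ψ : ℝ} {t : ℕ} (hα : 0 < α) (hα2 : α < 1 / 2)
    (hζ : 0 < ζ) (hψ : 0 < ψ) (ht : 1 ≤ t) :
    relaxedRank ζ (paretoQuantile α) ψ t / 2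
      ≤ max (ψ / t) ((4 * ψ * ζ ^ 2 / (α ^ 2 * t)) ^ (1 / (1 - 2 * α))) := by
  have ht0 : (0 : ℝ) < t := by exact_mod_cast ht
  have he : 0 < 1 - 2 * α := by linarith
  refine relaxedRank_half_le fun _ => ?_
  set m := max (ψ / t) ((4 * ψ * ζ ^ 2 / (α ^ 2 * t)) ^ (1 / (1 - 2 * α))) with hm
  have hm0 : 0 < m := lt_of_lt_of_le (by positivity) (le_max_left _ _)
  refine ⟨hm0, relaxedComplexity_pareto_le hα hm0 (κ := α / 2) (by positivity)
    (half_le_one_sub_two_rpow_neg hα.le (by linarith)) ?_ ?_⟩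
  · rw [div_le_iff₀ hm0, ← div_le_iff₀' (by positivity), one_div_div]
    exact le_max_left _ _
  · have h1 : 4 * ψ * ζ ^ 2 / (α ^ 2 * t) ≤ m ^ (1 - 2 * α) := by
      have := Real.rpow_le_rpow (z := 1 - 2 * α) (by positivity)
        (le_max_right (ψ / t) ((4 * ψ * ζ ^ 2 / (α ^ 2 * t)) ^ (1 / (1 - 2 * α)))) he.le
      rwa [← Real.rpow_mul (by positivity), one_div_mul_cancel he.ne', Real.rpow_one, ← hm] at this
    have h2 : m * paretoQuantile α m ^ 2 = m ^ (1 - 2 * α) := by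
      rw [paretoQuantile, ← Real.rpow_mul_natCast hm0.le, ← Real.rpow_one_add' hm0.le]
      · congr 1; push_cast; ring
      · push_cast; linarith
    rw [div_le_iff₀ (by positivity), ← h2] at h1
    rw [div_mul_eq_mul_div, div_mul_eq_mul_div, le_div_iff₀ hψ]
    nlinarith

theorem relaxedRank_pareto_le_of_ge {α ζ ψ : ℝ} {t : ℕ} (hα2 : 1 / 2 ≤ α)
    (hψ : 0 < ψ) (ht : 1 ≤ t) :
    relaxedRank ζ (paretoQuantile α) ψ t / 2
      ≤ max (ψ / t) (if t < ψ * (16 * ζ ^ 2) ^ (1 / (2 * α)) then 1 else 0) := by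
  have ht0 : (0 : ℝ) < t := by exact_mod_cast ht
  have hα : 0 < α := by linarith
  refine relaxedRank_half_le fun hlt => ?_
  split_ifs at hlt ⊢ with hc
  -- When the indicator is one, the candidate is at least one and no test is needed.
  · exact absurd ((le_max_right (ψ / t) 1).trans_lt hlt) (by norm_num)
  · have h0 : 0 < ψ / t := by positivity
    rw [max_eq_left h0.le]
    refine ⟨h0, relaxedComplexity_pareto_le hα h0 (κ := 1 / 4) (by norm_num)
      (quarter_le_one_sub_two_rpow_neg hα2) (one_div_div _ _).le ?_⟩
    have h1 : (16 * ζ ^ 2) ^ (1 / (2 * α)) ≤ t / ψ := by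
      rw [le_div_iff₀ hψ]; linarith
    have h2 : 16 * ζ ^ 2 ≤ (t / ψ) ^ (2 * α) := by
      have := Real.rpow_le_rpow (z := 2 * α) (by positivity) h1 (by positivity)
      rwa [← Real.rpow_mul (by positivity), one_div_mul_cancel (by positivity),
        Real.rpow_one] at this
    have h3 : paretoQuantile α (ψ / t) ^ 2 = (t / ψ) ^ (2 * α) := by
      rw [paretoQuantile, Real.rpow_neg h0.le, ← Real.inv_rpow h0.le, inv_div,
        ← Real.rpow_mul_natCast (by positivity)]
      congr 1; push_cast; ring
    rw [mul_pow, h3, div_mul_div_cancel₀ hψ.ne', div_self ht0.ne']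
    linarith

theorem max_rank_bound_le_of_lt {α ζ ψ t τ : ℝ} (hα : 0 < α) (hα2 : α < 1 / 2)
    (hψ : 0 < ψ) (ht : 0 < t) (hτ : τ = t / (16 * ψ)) :
    max (ψ / t) ((4 * ψ * ζ ^ 2 / (α ^ 2 * t)) ^ (1 / (1 - 2 * α)))
      ≤ max (1 / τ) ((ζ ^ 2 / (α ^ 2 * τ)) ^ (1 / (1 - 2 * α))) := by
  have he : 0 < 1 - 2 * α := by linarith
  subst hτ
  refine max_le_max ?_ (Real.rpow_le_rpow (by positivity) ?_ (by positivity))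
  · rw [one_div_div]; gcongr; linarith
  · rw [div_le_div_iff₀ (by positivity) (by positivity)]
    have : 4 * ψ * ζ ^ 2 * (α ^ 2 * (t / (16 * ψ))) = ζ ^ 2 * (α ^ 2 * t) / 4 := by
      field_simp; ring
    rw [this]
    linarith [show 0 ≤ ζ ^ 2 * (α ^ 2 * t) by positivity]

theorem four_rpow_le {α : ℝ} (hα2 : 1 / 2 ≤ α) : (4 : ℝ) ^ (1 / (2 * α)) ≤ 4 := by
  have : (4 : ℝ) ^ (1 / (2 * α)) ≤ 4 ^ (1 : ℝ) := by
    refine Real.rpow_le_rpow_of_exponent_le (by norm_num) ?_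
    rw [div_le_one (by linarith)]; linarith
  simpa using this

/-- Since `1/(2α) ≤ 1`, extracting a factor 4 from the base costs at most 4, which the constants 16
and 32 in the rescaled times absorb. -/
theorem sixteen_rpow_le {α ζ : ℝ} (hα2 : 1 / 2 ≤ α) :
    (16 * ζ ^ 2) ^ (1 / (2 * α)) ≤ 4 * (4 * ζ ^ 2) ^ (1 / (2 * α)) := by
  rw [show 16 * ζ ^ 2 = 4 * (4 * ζ ^ 2) by ring, Real.mul_rpow (by norm_num) (by positivity)]
  gcongr
  exact four_rpow_le hα2

theorem max_rank_bound_le_of_ge {α ζ ψ t τ : ℝ} (hα2 : 1 / 2 ≤ α)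
    (hψ : 0 < ψ) (ht : 0 < t) (hτ : τ = t / (16 * ψ)) :
    max (ψ / t) (if t < ψ * (16 * ζ ^ 2) ^ (1 / (2 * α)) then 1 else 0)
      ≤ max (1 / τ) (if τ < (4 * ζ ^ 2) ^ (1 / (2 * α)) then 1 else 0) := by
  subst hτ
  refine max_le_max ?_ ?_
  · rw [one_div_div]; gcongr; linarith
  · by_cases h : t < ψ * (16 * ζ ^ 2) ^ (1 / (2 * α))
    · rw [if_pos h, if_pos]
      rw [div_lt_iff₀ (by positivity)]
      have := sixteen_rpow_le (ζ := ζ) hα2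
      have h0 : 0 ≤ (4 * ζ ^ 2) ^ (1 / (2 * α)) := by positivity
      nlinarith [mul_le_mul_of_nonneg_left this hψ.le, mul_nonneg h0 hψ.le]
    · rw [if_neg h]
      split_ifs <;> norm_num

/-- A rank bound in terms of a rescaled time gives the corresponding reward bound. -/
theorem pareto_reward_bound_of_lt {α ζ ψ γ τ : ℝ} {t : ℕ} (hα : 0 < α) (hα2 : α < 1 / 2)
    (hζ : 0 < ζ) (hψ : 0 < ψ) (ht : 1 ≤ t) (hγ : 0 < γ)
    (h : γ ≤ relaxedRank ζ (paretoQuantile α) ψ t) (hτ : τ = t / (32 * ψ)) :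
    min (τ ^ α) ((α ^ 2 * τ / ζ ^ 2) ^ (α / (1 - 2 * α))) ≤ paretoQuantile α γ := by
  have ht0 : (0 : ℝ) < t := by exact_mod_cast ht
  have he : 0 < 1 - 2 * α := by linarith
  have hτ0 : 0 < τ := by rw [hτ]; positivity
  have h1 := relaxedRank_pareto_le_of_lt hα hα2 hζ hψ ht
  have hgen : ∀ x : ℝ, 0 < x → γ ≤ 1 / x → x ^ α ≤ paretoQuantile α γ := by
    intro x hx hgx
    rw [paretoQuantile, Real.rpow_neg hγ.le, ← Real.inv_rpow hγ.le]
    refine Real.rpow_le_rpow hx.le ?_ hα.le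
    rw [← one_div]
    exact (le_one_div hγ hx).1 hgx
  rcases le_max_iff.1 h1 with h2 | h2
  · refine (min_le_left _ _).trans (hgen τ hτ0 ?_)
    rw [hτ, one_div_div, mul_div_assoc]
    have : 0 < ψ / t := by positivity
    linarith
  · refine (min_le_right _ _).trans ?_
    rw [div_eq_mul_inv α, mul_comm α, Real.rpow_mul (by positivity)]
    refine hgen _ (by positivity) ?_
    rw [one_div, ← Real.inv_rpow (by positivity), inv_div, ← one_div (1 - 2 * α)]
    -- The exponent is at least one, so the factor 2 between the rank and its half moves inside the
    -- power; this turns 4 into 8, below the available 32.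
    have h3 : (2 : ℝ) ≤ 2 ^ (1 / (1 - 2 * α)) := by
      have : (2 : ℝ) ^ (1 : ℝ) ≤ 2 ^ (1 / (1 - 2 * α)) := by
        refine Real.rpow_le_rpow_of_exponent_le (by norm_num) ?_
        rw [le_div_iff₀ he]; linarith
      simpa using this
    calc γ ≤ 2 * (4 * ψ * ζ ^ 2 / (α ^ 2 * t)) ^ (1 / (1 - 2 * α)) := by linarith
      _ ≤ 2 ^ (1 / (1 - 2 * α)) * (4 * ψ * ζ ^ 2 / (α ^ 2 * t)) ^ (1 / (1 - 2 * α)) := by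
        gcongr
      _ = (2 * (4 * ψ * ζ ^ 2 / (α ^ 2 * t))) ^ (1 / (1 - 2 * α)) :=
        (Real.mul_rpow (by norm_num) (by positivity)).symm
      _ ≤ _ := by
        refine Real.rpow_le_rpow (by positivity) ?_ (by positivity)
        rw [hτ]
        have e1 : ζ ^ 2 / (α ^ 2 * (t / (32 * ψ))) = 32 * (ψ * ζ ^ 2 / (α ^ 2 * t)) := by
          field_simp
        have e2 : 2 * (4 * ψ * ζ ^ 2 / (α ^ 2 * t)) = 8 * (ψ * ζ ^ 2 / (α ^ 2 * t)) := by ring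
        rw [e1, e2]
        gcongr
        norm_num

theorem pareto_reward_bound_of_ge {α ζ ψ γ τ : ℝ} {t : ℕ} (hα2 : 1 / 2 ≤ α)
    (hψ : 0 < ψ) (ht : 1 ≤ t) (hγ : 0 < γ)
    (h : γ ≤ relaxedRank ζ (paretoQuantile α) ψ t) (hτ : τ = t / (32 * ψ)) :
    τ ^ α * (if (4 * ζ ^ 2) ^ (1 / (2 * α)) ≤ τ then 1 else 0) ≤ paretoQuantile α γ := by
  have ht0 : (0 : ℝ) < t := by exact_mod_cast ht
  have hτ0 : 0 < τ := by rw [hτ]; positivity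
  have h1 := relaxedRank_pareto_le_of_ge (ζ := ζ) hα2 hψ ht
  split_ifs with hc
  -- Here `ψ (16ζ²)^(1/(2α)) ≤ 4ψτ ≤ 32ψτ = t`, so the indicator in the rank bound vanishes.
  · have hn : ¬ ((t : ℝ) < ψ * (16 * ζ ^ 2) ^ (1 / (2 * α))) := by
      rw [not_lt]
      have h16 := sixteen_rpow_le (ζ := ζ) hα2
      have ht' : (t : ℝ) = 32 * ψ * τ := by rw [hτ]; field_simp
      have := mul_le_mul_of_nonneg_left (h16.trans (mul_le_mul_of_nonneg_left hc (by norm_num)))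
        hψ.le
      nlinarith [mul_pos hψ hτ0]
    rw [if_neg hn, max_eq_left (by positivity)] at h1
    rw [mul_one, paretoQuantile, Real.rpow_neg hγ.le, ← Real.inv_rpow hγ.le]
    refine Real.rpow_le_rpow hτ0.le ?_ (by linarith)
    rw [← one_div]
    refine (le_one_div hγ hτ0).1 ?_
    rw [hτ, one_div_div, mul_div_assoc]
    have : 0 < ψ / t := by positivity
    linarith
  · rw [mul_zero]
    exact Real.rpow_nonneg hγ.le _

/-! ### Consequences of a bound on the relaxed complexity -/

/-- Only the gap to the worst rank `ν = 1` is extracted; it is positive because `η < 1`. -/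
theorem of_relaxedComplexity_pareto_le {α ζ η c : ℝ} (hα : 0 < α) (hη : 0 < η) (hη2 : η < 1 / 2)
    (hc : 0 ≤ c) (h : relaxedComplexity ζ (paretoQuantile α) η ≤ ENNReal.ofReal c) :
    1 ≤ c * η ∧ ζ ^ 2 ≤ c * η * (paretoQuantile α η - 1) ^ 2 := by
  have h1 : gapFn ζ (paretoQuantile α) η 1 ≤ ENNReal.ofReal c :=
    le_trans (le_iSup₂ (f := fun ν (_ : ν ∈ Icc (2 * η) 1) => gapFn ζ (paretoQuantile α) η ν) 1
      ⟨by linarith, le_rfl⟩) h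
  have h2 := (le_max_left _ _).trans h1
  have h3 := (le_max_right _ _).trans h1
  have hD : 0 < paretoQuantile α η - paretoQuantile α 1 := by
    rw [sub_pos]
    exact Real.rpow_lt_rpow_of_neg hη (by linarith) (by linarith)
  constructor
  · rw [ENNReal.ofReal_le_ofReal_iff hc, div_le_iff₀ hη] at h3
    exact h3
  · rw [ENNReal.div_le_iff (by simpa using by positivity) ENNReal.ofReal_ne_top,
      ← ENNReal.ofReal_mul hc, ENNReal.ofReal_le_ofReal_iff (by positivity)] at h2
    have : paretoQuantile α 1 = 1 := Real.one_rpow _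
    rw [this] at h2
    linarith

/-- Convexity of `exp` on the chord from `-αL` to `0`. The ratio `y/L` does not involve `α`, which
makes the gap comparison uniform in `α`. -/
theorem one_sub_exp_neg_mul_le {α y L : ℝ} (hy : 0 ≤ y) (hL : 0 < L) (hyL : y ≤ L) :
    y / L * (1 - Real.exp (-(α * L))) ≤ 1 - Real.exp (-(α * y)) := by
  have h := convexOn_exp.2 (mem_univ (-(α * L))) (mem_univ 0) (div_nonneg hy hL.le)
    (sub_nonneg.2 ((div_le_one hL).2 hyL)) (by ring)
  simp only [smul_eq_mul, mul_zero, add_zero, Real.exp_zero, mul_one] at h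
  have e : y / L * -(α * L) = -(α * y) := by field_simp
  rw [e] at h
  linarith

theorem exp_neg_quarter_le_div {y L : ℝ} (hy : 1 / 2 ≤ y) (hyL : y ≤ L) :
    Real.exp (-((L - y) / 4)) / 4 ≤ y / L := by
  have h := Real.quadratic_le_exp_of_nonneg (x := (L - y) / 4) (by linarith)
  have hL : 0 < L := by linarith
  rw [Real.exp_neg, div_le_div_iff₀ (by norm_num) hL, inv_mul_le_iff₀ (Real.exp_pos _)]
  obtain ⟨z, rfl⟩ : ∃ z, L = y + z := ⟨L - y, by ring⟩
  rw [add_sub_cancel_left] at h ⊢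
  have hz : 0 ≤ z := by linarith
  -- The worst case is `y = 1/2`, where four times the difference is `(z - 4)²/4 + 2`.
  have h1 : y + z ≤ (1 + z / 4 + (z / 4) ^ 2 / 2) * (y * 4) := by
    nlinarith [sq_nonneg (z - 4), mul_nonneg hz (sub_nonneg.2 hy),
      mul_nonneg (sq_nonneg z) (sub_nonneg.2 hy)]
  refine h1.trans (mul_le_mul_of_nonneg_right h (by linarith))

/-- The gap of a rank `ν ≥ 2η` to `η` is at least a multiple `ν ^ (1 / 4) / 4` of the gap of the
worst rank. -/
theorem pareto_gap_lower {α η ν : ℝ} (hα : 0 < α) (hη : 0 < η) (hν : 2 * η ≤ ν) (hν1 : ν ≤ 1) :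
    ν ^ (1 / 4 : ℝ) / 4 * (paretoQuantile α η - 1)
      ≤ paretoQuantile α η - paretoQuantile α ν := by
  have hν0 : 0 < ν := by linarith
  -- In these coordinates the gap is `e^(αL) (1 - e^(-αy))` and `L - y = -log ν`; `ν ≥ 2η` gives `y
  -- ≥ log 2 > 1/2`.
  set y := Real.log ν - Real.log η with hy
  set L := -Real.log η with hL
  have hy2 : 1 / 2 ≤ y := by
    have h1 : Real.log (2 * η) ≤ Real.log ν := Real.log_le_log (by linarith) hν
    rw [Real.log_mul (by norm_num) hη.ne'] at h1
    linarith [Real.log_two_gt_d9]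
  have hlν : Real.log ν ≤ 0 := Real.log_nonpos hν0.le hν1
  have hyL : y ≤ L := by linarith
  have hL0 : 0 < L := by linarith
  have h1 := one_sub_exp_neg_mul_le (α := α) (by linarith : 0 ≤ y) hL0 hyL
  have h2 := exp_neg_quarter_le_div hy2 hyL
  have eη : paretoQuantile α η = Real.exp (α * L) := by
    rw [paretoQuantile, Real.rpow_def_of_pos hη]; congr 1; rw [hL]; ring
  have eν : paretoQuantile α ν = Real.exp (α * L) * Real.exp (-(α * y)) := by
    rw [paretoQuantile, Real.rpow_def_of_pos hν0, ← Real.exp_add]; congr 1; rw [hL, hy]; ring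
  have e4 : ν ^ (1 / 4 : ℝ) = Real.exp (-((L - y) / 4)) := by
    rw [Real.rpow_def_of_pos hν0]; congr 1; rw [hL, hy]; ring
  have hE : Real.exp (α * L) * Real.exp (-(α * L)) = 1 := by
    rw [← Real.exp_add]; simp
  have hpos : 0 ≤ 1 - Real.exp (-(α * L)) := by
    rw [sub_nonneg, Real.exp_le_one_iff]; nlinarith
  rw [eη, eν, e4]
  calc _ = Real.exp (α * L) *
        (Real.exp (-((L - y) / 4)) / 4 * (1 - Real.exp (-(α * L)))) := by
        linear_combination (-(Real.exp (-((L - y) / 4)) / 4)) * (-hE)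
    _ ≤ Real.exp (α * L) * (1 - Real.exp (-(α * y))) := by
        gcongr
        exact (mul_le_mul_of_nonneg_right h2 hpos).trans h1
    _ = _ := by ring

/-- Squaring turns the loss `ν^(1/4)` into `√ν`, whose inverse is still integrable for a uniform
rank. -/
theorem pareto_gap_sq_lower {α ζ η ν c : ℝ} (hα : 0 < α) (hη : 0 < η) (hν : 2 * η ≤ ν)
    (hν1 : ν ≤ 1) (hc : 0 < c) (h : ζ ^ 2 ≤ c * η * (paretoQuantile α η - 1) ^ 2) :
    √ν * ζ ^ 2 ≤ 16 * (c * η) * (paretoQuantile α η - paretoQuantile α ν) ^ 2 := by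
  have hg := pareto_gap_lower hα hη hν hν1
  have hD : 0 ≤ paretoQuantile α η - 1 := by
    have := paretoQuantile_anti hα hη (by linarith : η ≤ 1)
    rw [show paretoQuantile α 1 = 1 from Real.one_rpow _] at this
    linarith
  have hν0 : 0 ≤ ν := by linarith
  have hsq : √ν = (ν ^ (1 / 4 : ℝ)) ^ 2 := by
    rw [Real.sqrt_eq_rpow, ← Real.rpow_mul_natCast hν0]; norm_num
  have h1 : (ν ^ (1 / 4 : ℝ) / 4 * (paretoQuantile α η - 1)) ^ 2
      ≤ (paretoQuantile α η - paretoQuantile α ν) ^ 2 := by gcongr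
  calc √ν * ζ ^ 2 ≤ √ν * (c * η * (paretoQuantile α η - 1) ^ 2) := by gcongr
    _ = 16 * (c * η) * (ν ^ (1 / 4 : ℝ) / 4 * (paretoQuantile α η - 1)) ^ 2 := by
      rw [hsq]; ring
    _ ≤ _ := by gcongr

/-! ### Concentration inequalities -/

section Concentration

variable {Ω : Type*} [MeasurableSpace Ω] {μ : Measure Ω}

theorem measureReal_abs_sum_range_ge_le [IsProbabilityMeasure μ] {X : ℕ → Ω → ℝ}
    (hindep : iIndepFun X μ) {c : NNReal}
    (hX : ∀ i, HasSubgaussianMGF (X i) c μ) (n : ℕ) {y : ℝ} (hy : 0 ≤ y) :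
    μ.real {ω | y ≤ |∑ i ∈ Finset.range n, X i ω|} ≤ 2 * Real.exp (-y ^ 2 / (2 * n * c)) := by
  have h1 := HasSubgaussianMGF.measure_sum_range_ge_le_of_iIndepFun hindep (n := n)
    (fun i _ => hX i) hy
  have hindep' : iIndepFun (fun i => -X i) μ :=
    hindep.comp (fun _ x => -x) (fun _ => measurable_neg)
  have h2 := HasSubgaussianMGF.measure_sum_range_ge_le_of_iIndepFun hindep' (n := n)
    (fun i _ => (hX i).neg) hy
  have hsub : {ω | y ≤ |∑ i ∈ Finset.range n, X i ω|} ⊆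
      {ω | y ≤ ∑ i ∈ Finset.range n, X i ω} ∪ {ω | y ≤ ∑ i ∈ Finset.range n, (-X i) ω} := by
    intro ω hω
    simp only [Pi.neg_apply, Finset.sum_neg_distrib]
    exact le_abs.1 (show y ≤ |∑ i ∈ Finset.range n, X i ω| from hω)
  calc _ ≤ _ := measureReal_mono hsub
    _ ≤ _ := measureReal_union_le _ _
    _ ≤ _ := by linarith

theorem exp_mul_le_of_mem_Icc (θ : ℝ) {x : ℝ} (hx : x ∈ Icc (0 : ℝ) 1) :
    Real.exp (θ * x) ≤ 1 + (Real.exp θ - 1) * x := by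
  have h := convexOn_exp.2 (mem_univ θ) (mem_univ 0) hx.1 (sub_nonneg.2 hx.2) (by ring)
  simp only [smul_eq_mul, mul_zero, add_zero, Real.exp_zero, mul_one] at h
  rw [mul_comm θ]
  linarith

theorem integrable_of_mem_Icc [IsFiniteMeasure μ] {f : Ω → ℝ} (hf : Measurable f)
    (h01 : ∀ ω, f ω ∈ Icc (0 : ℝ) 1) : Integrable f μ :=
  Integrable.of_bound hf.aestronglyMeasurable 1
    (ae_of_all _ fun ω => by rw [Real.norm_of_nonneg (h01 ω).1]; exact (h01 ω).2)

theorem integrable_exp_mul_sum [IsFiniteMeasure μ] {f : ℕ → Ω → ℝ}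
    (hf : ∀ i, Measurable (f i)) (h01 : ∀ i ω, f i ω ∈ Icc (0 : ℝ) 1) (s : Finset ℕ) (θ : ℝ) :
    Integrable (fun ω => Real.exp (θ * (∑ i ∈ s, f i) ω)) μ := by
  have hm : Measurable fun ω => ∑ i ∈ s, f i ω := Finset.measurable_sum s fun i _ => hf i
  simp only [Finset.sum_apply]
  refine Integrable.of_bound (by fun_prop) (Real.exp (|θ| * s.card)) (ae_of_all _ fun ω => ?_)
  rw [Real.norm_of_nonneg (Real.exp_pos _).le, Real.exp_le_exp]
  have h0 : 0 ≤ ∑ i ∈ s, f i ω := Finset.sum_nonneg fun i _ => (h01 i ω).1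
  have h1 : ∑ i ∈ s, f i ω ≤ s.card := by
    simpa using Finset.sum_le_card_nsmul s (fun i => f i ω) 1 fun i _ => (h01 i ω).2
  calc θ * ∑ i ∈ s, f i ω ≤ |θ| * ∑ i ∈ s, f i ω := by gcongr; exact le_abs_self _
    _ ≤ _ := by gcongr

/-- The Poisson-type bound behind multiplicative Chernoff inequalities: the chord bound for `exp` on
`[0,1]`, then `1 + x ≤ e^x` for each factor. -/
theorem mgf_sum_le_of_mem_Icc [IsProbabilityMeasure μ] {f : ℕ → Ω → ℝ} (hindep : iIndepFun f μ)
    (hf : ∀ i, Measurable (f i)) (h01 : ∀ i ω, f i ω ∈ Icc (0 : ℝ) 1) (s : Finset ℕ) (θ : ℝ) :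
    mgf (∑ i ∈ s, f i) μ θ ≤ Real.exp ((Real.exp θ - 1) * ∑ i ∈ s, ∫ ω, f i ω ∂μ) := by
  rw [hindep.mgf_sum hf s, Finset.mul_sum, Real.exp_sum]
  refine Finset.prod_le_prod (fun i _ => mgf_nonneg) fun i _ => ?_
  have hi := integrable_of_mem_Icc (μ := μ) (hf i) (h01 i)
  calc mgf (f i) μ θ ≤ ∫ ω, 1 + (Real.exp θ - 1) * f i ω ∂μ := by
        refine integral_mono ?_ ((integrable_const _).add (hi.const_mul _))
          fun ω => exp_mul_le_of_mem_Icc θ (h01 i ω)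
        simpa using integrable_exp_mul_sum (μ := μ) hf h01 {i} θ
    _ = (Real.exp θ - 1) * ∫ ω, f i ω ∂μ + 1 := by
        rw [integral_add (integrable_const _) (hi.const_mul _), integral_const_mul]
        simp [add_comm]
    _ ≤ _ := Real.add_one_le_exp _

/-- Chernoff's bound with parameter `1`, using `e - 1 < 2`. -/
theorem measureReal_sum_ge_le [IsProbabilityMeasure μ] {f : ℕ → Ω → ℝ} (hindep : iIndepFun f μ)
    (hf : ∀ i, Measurable (f i)) (h01 : ∀ i ω, f i ω ∈ Icc (0 : ℝ) 1) (s : Finset ℕ) {m : ℝ}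
    (hm : ∑ i ∈ s, ∫ ω, f i ω ∂μ ≤ m) (y : ℝ) :
    μ.real {ω | 2 * m + y ≤ ∑ i ∈ s, f i ω} ≤ Real.exp (-y) := by
  have h := measure_ge_le_exp_mul_mgf (μ := μ) (X := ∑ i ∈ s, f i) (t := 1) (2 * m + y)
    zero_le_one (integrable_exp_mul_sum hf h01 s 1)
  simp only [Finset.sum_apply] at h
  have hm0 : 0 ≤ m := le_trans
    (Finset.sum_nonneg fun i _ => integral_nonneg fun ω => (h01 i ω).1) hm
  have he := Real.exp_one_lt_d9
  have he' := Real.exp_one_gt_d9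
  calc _ ≤ _ := h
    _ ≤ Real.exp (-1 * (2 * m + y)) * Real.exp ((Real.exp 1 - 1) * ∑ i ∈ s, ∫ ω, f i ω ∂μ) := by
      gcongr
      exact mgf_sum_le_of_mem_Icc hindep hf h01 s 1
    _ ≤ Real.exp (-y) := by
      rw [← Real.exp_add, Real.exp_le_exp]
      nlinarith

/-- Chernoff's bound with parameter `-1`, using `1 - 1/e ≥ 1/2`. -/
theorem measureReal_sum_le_le [IsProbabilityMeasure μ] {f : ℕ → Ω → ℝ} (hindep : iIndepFun f μ)
    (hf : ∀ i, Measurable (f i)) (h01 : ∀ i ω, f i ω ∈ Icc (0 : ℝ) 1) (s : Finset ℕ) {m : ℝ}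
    (hm0 : 0 ≤ m) (hm : m ≤ ∑ i ∈ s, ∫ ω, f i ω ∂μ) (x : ℝ) :
    μ.real {ω | ∑ i ∈ s, f i ω ≤ x} ≤ Real.exp (x - m / 2) := by
  have h := measure_le_le_exp_mul_mgf (μ := μ) (X := ∑ i ∈ s, f i) (t := -1) x
    (by norm_num) (integrable_exp_mul_sum hf h01 s (-1))
  simp only [Finset.sum_apply] at h
  have he : Real.exp (-1) ≤ 1 / 2 := by
    rw [Real.exp_neg, one_div]
    exact inv_anti₀ (by norm_num) (by linarith [Real.exp_one_gt_d9])
  calc _ ≤ _ := h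
    _ ≤ Real.exp (-(-1) * x) * Real.exp ((Real.exp (-1) - 1) * ∑ i ∈ s, ∫ ω, f i ω ∂μ) := by
      gcongr
      exact mgf_sum_le_of_mem_Icc hindep hf h01 s (-1)
    _ ≤ Real.exp (x - m / 2) := by
      rw [← Real.exp_add, Real.exp_le_exp]
      nlinarith

open Classical in
theorem measureReal_count_le_le [IsProbabilityMeasure μ] {X : ℕ → Ω → ℝ} (hindep : iIndepFun X μ)
    (hX : ∀ i, Measurable (X i)) {A : ℕ → Set ℝ} (hA : ∀ i, MeasurableSet (A i)) (s : Finset ℕ)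
    {m : ℝ} (hm0 : 0 ≤ m) (hm : m ≤ ∑ i ∈ s, μ.real (X i ⁻¹' A i)) (x : ℝ) :
    μ.real {ω | ((s.filter fun i => X i ω ∈ A i).card : ℝ) ≤ x} ≤ Real.exp (x - m / 2) := by
  have hg : ∀ i, Measurable ((A i).indicator (1 : ℝ → ℝ)) :=
    fun i => measurable_one.indicator (hA i)
  have h := measureReal_sum_le_le (hindep.comp _ hg) (fun i => (hg i).comp (hX i))
    (fun i ω => ?_) s hm0 (x := x) (hm.trans_eq (Finset.sum_congr rfl fun i _ => ?_))
  · convert h using 5 with ω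
    simp [Set.indicator_apply]
  · by_cases h : X i ω ∈ A i <;> simp [h]
  · rw [← integral_indicator_one (hX i (hA i))]
    rfl

theorem measureReal_preimage_of_isUniform [IsProbabilityMeasure μ] {X : Ω → ℝ}
    (hX : pdf.IsUniform X (Icc 0 1) μ volume) {A : Set ℝ} (hA : MeasurableSet A) :
    μ.real (X ⁻¹' A) = volume.real (Icc (0 : ℝ) 1 ∩ A) := by
  rw [measureReal_def, hX.measure_preimage (by simp) (by simp) hA]
  simp [measureReal_def]

theorem map_eq_of_isUniform {X : Ω → ℝ} (hX : pdf.IsUniform X (Icc 0 1) μ volume) :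
    μ.map X = volume.restrict (Icc 0 1) := by
  rw [hX, ProbabilityTheory.cond]
  simp

/-- Dropping the minimum leaves `√p ∫ x^(-1/2) = 2√p` over `[0,1]`. -/
theorem integral_min_one_sqrt_div_le [IsProbabilityMeasure μ] {X : Ω → ℝ} (hXm : Measurable X)
    (hX : pdf.IsUniform X (Icc 0 1) μ volume) {p : ℝ} (hp : 0 ≤ p) :
    ∫ ω, min 1 √(p / X ω) ∂μ ≤ 2 * √p := by
  have hm : Measurable fun x : ℝ => min 1 √(p / x) := by fun_prop
  have e : ∫ ω, min 1 √(p / X ω) ∂μ = ∫ x in Icc (0 : ℝ) 1, min 1 √(p / x) := by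
    rw [← map_eq_of_isUniform hX, integral_map hXm.aemeasurable hm.aestronglyMeasurable]
  have hint : IntervalIntegrable (fun x : ℝ => √p * x ^ (-(1 / 2) : ℝ)) volume 0 1 :=
    (intervalIntegral.intervalIntegrable_rpow' (by norm_num)).const_mul _
  rw [e, integral_Icc_eq_integral_Ioc, ← intervalIntegral.integral_of_le zero_le_one]
  calc ∫ x in (0 : ℝ)..1, min 1 √(p / x) ≤ ∫ x in (0 : ℝ)..1, √p * x ^ (-(1 / 2) : ℝ) := by
        refine intervalIntegral.integral_mono_on_of_le_Ioo zero_le_one ?_ hint fun x hx => ?_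
        · rw [intervalIntegrable_iff_integrableOn_Ioc_of_le zero_le_one]
          refine Measure.integrableOn_of_bounded (M := 1) (by simp) hm.aestronglyMeasurable
            (ae_of_all _ fun x => ?_)
          rw [Real.norm_of_nonneg (le_min zero_le_one (Real.sqrt_nonneg _))]
          exact min_le_left _ _
        · refine (min_le_right _ _).trans_eq ?_
          rw [Real.sqrt_div hp, Real.rpow_neg hx.1.le, ← Real.sqrt_eq_rpow, div_eq_mul_inv]
    _ = 2 * √p := by
        rw [intervalIntegral.integral_const_mul, integral_rpow (Or.inl (by norm_num))]
        norm_num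
        ring

end Concentration

/-! ### A union bound over pairs -/

theorem sum_range_inv_sq_add_le (i n : ℕ) :
    ∑ j ∈ Finset.range n, (((i + j + 1 : ℕ) : ℝ) ^ 2)⁻¹ ≤ 2 / (i + 1) := by
  have h := sum_Ioo_inv_sq_le (α := ℝ) i (i + n + 1)
  refine le_trans (le_of_eq ?_) h
  rw [← Finset.Ico_add_one_left_eq_Ioo, Finset.sum_Ico_eq_sum_range]
  refine Finset.sum_congr (by congr 1; omega) fun j _ => ?_
  rw [show i + 1 + j = i + j + 1 by ring]

/-- Splitting off one factor `1/(i+1)` leaves inverse squares: the sum over `j` is at most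
`2c/(i+1)²`, and the sum over `i` then at most `4c`. -/
theorem measure_iUnion_pairs_le {Ω : Type*} [MeasurableSpace Ω] {μ : Measure Ω}
    [IsFiniteMeasure μ] {B : ℕ → ℕ → Set Ω} {c : ℝ} (hc : 0 ≤ c)
    (hB : ∀ i j, μ.real (B i j) ≤ c / ((i + j + 1 : ℕ) : ℝ) ^ 3) :
    μ (⋃ i, ⋃ j, B i j) ≤ ENNReal.ofReal (4 * c) := by
  -- The form `0 + i + 1` lets the inverse-square estimate apply again to the outer sum.
  have hinner : ∀ i, μ (⋃ j, B i j) ≤ ENNReal.ofReal (2 * c * (((0 + i + 1 : ℕ) : ℝ) ^ 2)⁻¹) := by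
    intro i
    refine (measure_iUnion_le _).trans (ENNReal.tsum_le_of_sum_range_le fun n => ?_)
    calc ∑ j ∈ Finset.range n, μ (B i j)
        ≤ ∑ j ∈ Finset.range n,
          ENNReal.ofReal (c / (i + 1) * (((i + j + 1 : ℕ) : ℝ) ^ 2)⁻¹) := by
          refine Finset.sum_le_sum fun j _ => ?_
          rw [← ofReal_measureReal]
          refine ENNReal.ofReal_le_ofReal ((hB i j).trans ?_)
          rw [← div_eq_mul_inv, div_div]
          refine div_le_div_of_nonneg_left hc (by positivity) ?_
          rw [pow_succ' _ 2]
          gcongr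
          push_cast
          linarith [(Nat.cast_nonneg j : (0 : ℝ) ≤ j)]
      _ = ENNReal.ofReal (∑ j ∈ Finset.range n, c / (i + 1) * (((i + j + 1 : ℕ) : ℝ) ^ 2)⁻¹) :=
          (ENNReal.ofReal_sum_of_nonneg fun j _ => by positivity).symm
      _ ≤ _ := by
          refine ENNReal.ofReal_le_ofReal ?_
          rw [← Finset.mul_sum]
          calc _ ≤ c / (i + 1) * (2 / (i + 1)) := by
                gcongr
                exact sum_range_inv_sq_add_le i n
            _ = _ := by push_cast; field_simp; ring
  refine (measure_iUnion_le _).trans (ENNReal.tsum_le_of_sum_range_le fun n => ?_)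
  calc ∑ i ∈ Finset.range n, μ (⋃ j, B i j)
      ≤ ∑ i ∈ Finset.range n, ENNReal.ofReal (2 * c * (((0 + i + 1 : ℕ) : ℝ) ^ 2)⁻¹) :=
        Finset.sum_le_sum fun i _ => hinner i
    _ = ENNReal.ofReal (∑ i ∈ Finset.range n, 2 * c * (((0 + i + 1 : ℕ) : ℝ) ^ 2)⁻¹) :=
        (ENNReal.ofReal_sum_of_nonneg fun j _ => by positivity).symm
    _ ≤ _ := by
        refine ENNReal.ofReal_le_ofReal ?_
        rw [← Finset.mul_sum]
        calc _ ≤ 2 * c * (2 / ((0 : ℕ) + 1)) := by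
              gcongr
              exact sum_range_inv_sq_add_le 0 n
          _ = _ := by push_cast; ring

/-! ### Runs of OSE on the event where the confidence bounds are valid -/

section Run

theorem numPulls_mono (pull : ℕ → ℕ) (a : ℕ) {s t : ℕ} (h : s ≤ t) :
    numPulls pull a s ≤ numPulls pull a t :=
  Finset.card_le_card (Finset.filter_subset_filter _ (Finset.Icc_subset_Icc_right h))

theorem scope_le {t : ℕ} (ht : 1 ≤ t) {u : ℝ} (hu : u ≤ 1) : scope t u ≤ t := by
  have h : (t : ℝ) ^ u ≤ (t : ℝ) ^ (1 : ℝ) :=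
    Real.rpow_le_rpow_of_exponent_le (by exact_mod_cast ht) hu
  rw [Real.rpow_one] at h
  exact (Nat.floor_mono h).trans_eq (Nat.floor_natCast t)

/-- With zero-based indices, arm `a` is in the scope only from time `a + 1` on. Hence the pair (arm,
number of pulls) alone bounds the time from below, and a union bound over such pairs covers all
times. -/
theorem add_numPulls_le {pull : ℕ → ℕ} {u : ℕ → ℝ} (hu : ∀ t ≥ 1, u t ≤ 1)
    (hpull : ∀ t ≥ 1, pull t < scope t (u t)) {a t : ℕ} (h : numPulls pull a t ≠ 0) :
    a + numPulls pull a t ≤ t := by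
  have hsub : (Finset.Icc 1 t).filter (fun s => pull s = a) ⊆ Finset.Icc (a + 1) t := by
    intro s hs
    simp only [Finset.mem_filter, Finset.mem_Icc] at hs ⊢
    have := (hpull s hs.1.1).trans_le (scope_le hs.1.1 (hu s hs.1.1))
    omega
  have hc := Finset.card_le_card hsub
  rw [Nat.card_Icc] at hc
  unfold numPulls at h ⊢
  omega

/-- At the last pull of `b` within `T`, all its other pulls within `T` are already counted. -/
theorem card_filter_pull_le {pull : ℕ → ℕ} {T : Finset ℕ} (hT : ∀ s ∈ T, 1 ≤ s) {b : ℕ} {M : ℝ}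
    (hM : 0 ≤ M) (h : ∀ s ∈ T, pull s = b → (numPulls pull b (s - 1) : ℝ) ≤ M) :
    ((T.filter fun s => pull s = b).card : ℝ) ≤ 1 + M := by
  rcases (T.filter fun s => pull s = b).eq_empty_or_nonempty with he | hne
  · rw [he, Finset.card_empty, Nat.cast_zero]
    positivity
  · have hmax := Finset.max'_mem _ hne
    set s := (T.filter fun s => pull s = b).max' hne
    rw [Finset.mem_filter] at hmax
    have hsub : (T.filter fun s => pull s = b).erase s ⊆
        (Finset.Icc 1 (s - 1)).filter fun s => pull s = b := by
      intro r hr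
      rw [Finset.mem_erase] at hr
      have hle := Finset.le_max' _ r hr.2
      have hr2 := Finset.mem_filter.1 hr.2
      have h1 := hT r hr2.1
      have h2 := hr.1
      change r ≤ s at hle
      simp only [Finset.mem_filter, Finset.mem_Icc]
      exact ⟨⟨h1, by omega⟩, hr2.2⟩
    have hc := Finset.card_le_card hsub
    have h1 := Finset.pred_card_le_card_erase (a := s) (s := T.filter fun s => pull s = b)
    have h2 : (T.filter fun s => pull s = b).card ≤ numPulls pull b (s - 1) + 1 := by
      unfold numPulls
      omega
    have h3 : ((T.filter fun s => pull s = b).card : ℝ) ≤ numPulls pull b (s - 1) + 1 := by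
      exact_mod_cast h2
    linarith [h s hmax.1 hmax.2]

theorem card_le_of_pull_bound {pull : ℕ → ℕ} {T : Finset ℕ} (hT : ∀ s ∈ T, 1 ≤ s) {n : ℕ}
    (hn : ∀ s ∈ T, pull s < n) {M : ℕ → ℝ} (hM : ∀ b, 0 ≤ M b)
    (h : ∀ s ∈ T, (numPulls pull (pull s) (s - 1) : ℝ) ≤ M (pull s)) :
    (T.card : ℝ) ≤ n + ∑ b ∈ Finset.range n, M b := by
  have hmap : ∀ s ∈ T, pull s ∈ Finset.range n := fun s hs => Finset.mem_range.2 (hn s hs)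
  rw [Finset.card_eq_sum_card_fiberwise (f := pull) hmap]
  push_cast
  calc _ ≤ ∑ b ∈ Finset.range n, (1 + M b) := by
        refine Finset.sum_le_sum fun b _ => card_filter_pull_le hT (hM b) fun s hs hb => ?_
        have := h s hs
        rwa [hb] at this
    _ = _ := by simp [Finset.sum_add_distrib]

variable {ζ : ℝ} {β : ℕ → ℝ} {lam : ℝ → ℝ} {γ : ℕ → ℝ} {ε : ℕ → ℕ → ℝ} {u : ℕ → ℝ}
  {pull rec : ℕ → ℕ}

/-- The noise bound carries the level `β (a + N)`, and `a + N ≤ t` allows `β t` instead. -/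
theorem abs_empMean_sub_le (hβ : ∀ s t : ℕ, 1 ≤ s → s ≤ t → β s ≤ β t)
    (hnoise : ∀ a N : ℕ, 1 ≤ N →
      |∑ s ∈ Finset.range N, ε a (s + 1)| ≤ √(ζ ^ 2 * β (a + N) * N))
    (hu : ∀ t ≥ 1, u t ≤ 1) (hpull : ∀ t ≥ 1, pull t < scope t (u t)) {a t : ℕ}
    (h : numPulls pull a t ≠ 0) :
    |empMean (reward lam γ ε) pull a t - lam (γ a)| ≤ √(ζ ^ 2 * β t / numPulls pull a t) := by
  have hle := add_numPulls_le hu hpull h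
  unfold empMean
  set N := numPulls pull a t
  have hN : 1 ≤ N := Nat.one_le_iff_ne_zero.2 h
  have hN0 : (0 : ℝ) < N := by exact_mod_cast hN
  have e1 : ∑ s ∈ Finset.Icc 1 N, reward lam γ ε a s
      = N * lam (γ a) + ∑ s ∈ Finset.range N, ε a (s + 1) := by
    rw [← Finset.Ico_add_one_right_eq_Icc, Finset.sum_Ico_eq_sum_range]
    simp [reward, Finset.sum_add_distrib, add_comm 1]
  rw [e1, add_div, mul_div_cancel_left₀ _ hN0.ne', add_sub_cancel_left, abs_div,
    abs_of_pos hN0, div_le_iff₀ hN0]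
  refine (hnoise a N hN).trans ?_
  have e2 : √(ζ ^ 2 * β t / N) * N = √(ζ ^ 2 * β t * N) := by
    rw [← Real.sqrt_sq hN0.le, ← Real.sqrt_mul' _ (by positivity), Real.sqrt_sq hN0.le]
    congr 1
    field_simp
  rw [e2]
  have := hβ (a + N) t (by omega) hle
  gcongr

section Bounds

variable {X : ℕ → ℕ → ℝ} {m : ℝ} {a t : ℕ}

theorem le_ucb (h : numPulls pull a t ≠ 0 →
      |empMean X pull a t - m| ≤ √(ζ ^ 2 * β t / numPulls pull a t)) :
    (m : EReal) ≤ ucb ζ β X pull a t := by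
  unfold ucb
  split_ifs with h0
  · exact le_top
  · rw [EReal.coe_le_coe_iff]
    linarith [(abs_le.1 (h h0)).1]

theorem ucb_le (h0 : numPulls pull a t ≠ 0)
    (h : |empMean X pull a t - m| ≤ √(ζ ^ 2 * β t / numPulls pull a t)) :
    ucb ζ β X pull a t ≤ ((m + 2 * √(ζ ^ 2 * β t / numPulls pull a t) : ℝ) : EReal) := by
  rw [ucb, if_neg h0, EReal.coe_le_coe_iff]
  linarith [(abs_le.1 h).2]

theorem lcb_le (h : numPulls pull a t ≠ 0 →
      |empMean X pull a t - m| ≤ √(ζ ^ 2 * β t / numPulls pull a t)) :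
    lcb ζ β X pull a t ≤ (m : EReal) := by
  unfold lcb
  split_ifs with h0
  · exact bot_le
  · rw [EReal.coe_le_coe_iff]
    linarith [(abs_le.1 (h h0)).2]

theorem le_lcb (h0 : numPulls pull a t ≠ 0)
    (h : |empMean X pull a t - m| ≤ √(ζ ^ 2 * β t / numPulls pull a t)) :
    ((m - 2 * √(ζ ^ 2 * β t / numPulls pull a t) : ℝ) : EReal) ≤ lcb ζ β X pull a t := by
  rw [lcb, if_neg h0, EReal.coe_le_coe_iff]
  linarith [(abs_le.1 h).1]

end Bounds

/-- From a gap bounded by a multiple of the width of a confidence interval to a number of pulls. -/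
theorem pulls_le_of_gap_le {g κ B c η ν n : ℝ} (hζ : 0 < ζ) (hB : 0 ≤ B)
    (hn : 0 < n) (hν : 0 < ν) (hη : 0 < η) (hc : 0 < c) (hg0 : 0 ≤ g)
    (hg : g ≤ κ * √(ζ ^ 2 * B / n)) (hgap : √ν * ζ ^ 2 ≤ 16 * (c * η) * g ^ 2) :
    n ≤ 16 * κ ^ 2 * (c * B) * (η / √ν) := by
  have h1 : g ^ 2 ≤ κ ^ 2 * (ζ ^ 2 * B / n) := by
    have := pow_le_pow_left₀ hg0 hg 2
    rwa [mul_pow, Real.sq_sqrt (by positivity)] at this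
  have h2 : √ν * ζ ^ 2 ≤ 16 * (c * η) * (κ ^ 2 * (ζ ^ 2 * B / n)) :=
    hgap.trans (by gcongr)
  have hs : 0 < √ν := Real.sqrt_pos.2 hν
  have e : 16 * (c * η) * (κ ^ 2 * (ζ ^ 2 * B / n))
      = 16 * κ ^ 2 * (c * B) * η / n * ζ ^ 2 := by ring
  rw [e] at h2
  have h3 := le_of_mul_le_mul_right h2 (by positivity)
  rw [le_div_iff₀ hn] at h3
  rw [← mul_div_assoc, le_div_iff₀ hs]
  linarith

/-- If the recommended arm has rank larger than `2η`, then an arm pulled while the scope contains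
an arm of rank at most `p ≤ η` was not pulled often before. -/
theorem numPulls_le_of_rec_rank_gt {α η p c : ℝ} {t s a : ℕ} (hα : 0 < α) (hζ : 0 < ζ)
    (hβ0 : ∀ s : ℕ, 1 ≤ s → 0 ≤ β s) (hβ : ∀ s t : ℕ, 1 ≤ s → s ≤ t → β s ≤ β t)
    (hnoise : ∀ a N : ℕ, 1 ≤ N →
      |∑ s ∈ Finset.range N, ε a (s + 1)| ≤ √(ζ ^ 2 * β (a + N) * N))
    (hu : ∀ t ≥ 1, u t ≤ 1) (hγ : ∀ a, γ a ∈ Ioc (0 : ℝ) 1)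
    (hrun : IsOSERun ζ β (reward (paretoQuantile α) γ ε) u pull rec)
    (hη2 : η < 1 / 2) (hc : 0 < c)
    (hcη : ζ ^ 2 ≤ c * η * (paretoQuantile α η - 1) ^ 2)
    (hp : 0 < p) (hpη : p ≤ η) (hηp : η ≤ 2 * p) (hrec : 2 * η < γ (rec t))
    (ha : γ a ≤ p) (hs : 1 ≤ s) (hst : s ≤ t) (has : a < scope s (u s)) :
    (numPulls pull (pull s) (s - 1) : ℝ)
      ≤ 512 * (c * β t) * √η * min 1 √(p / γ (pull s)) := by
  have hη : 0 < η := hp.trans_le hpη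
  have hβt : 0 ≤ β t := hβ0 t (hs.trans hst)
  have habs := fun a t => abs_empMean_sub_le (lam := paretoQuantile α) (γ := γ) (a := a) (t := t)
    hβ hnoise hu hrun.pull_mem_scope
  rcases eq_or_ne (numPulls pull (pull s) (s - 1)) 0 with h0 | h0
  · rw [h0, Nat.cast_zero]
    positivity
  set b := pull s with hb
  set n := numPulls pull b (s - 1) with hn
  have hn1 : (0 : ℝ) < n := by exact_mod_cast Nat.pos_of_ne_zero h0
  have hs2 : 1 ≤ s - 1 := by
    have := add_numPulls_le hu hrun.pull_mem_scope h0
    omega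
  have hνb := hγ b
  -- Optimism: arm `a` is in the scope, so the UCB of the pulled arm is at least `λ_(γ a) ≥ λ_η`.
  have hucb : paretoQuantile α η ≤ paretoQuantile α (γ b) + 2 * √(ζ ^ 2 * β t / n) := by
    have h1 := (le_ucb (habs a (s - 1))).trans
      ((hrun.pull_argmax s hs a has).trans (ucb_le h0 (habs b (s - 1) h0)))
    rw [EReal.coe_le_coe_iff] at h1
    have h2 := paretoQuantile_anti hα (hγ a).1 (ha.trans hpη)
    have h3 : √(ζ ^ 2 * β (s - 1) / n) ≤ √(ζ ^ 2 * β t / n) := by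
      have := hβ (s - 1) t hs2 (by omega)
      gcongr
    linarith
  have hsη : 0 < √η := Real.sqrt_pos.2 hη
  have hηη : √η * √η = η := Real.mul_self_sqrt hη.le
  rcases le_or_gt (2 * η) (γ b) with hν | hν
  · have hanti := paretoQuantile_anti hα hη (by linarith : η ≤ γ b)
    have h := pulls_le_of_gap_le (κ := 2) hζ hβt hn1 hνb.1 hη hc (sub_nonneg.2 hanti)
      (by linarith) (pareto_gap_sq_lower hα hη hν hνb.2 hc hcη)
    have hsν : 0 < √(γ b) := Real.sqrt_pos.2 hνb.1
    have hmin : min 1 √(p / γ b) = √p / √(γ b) := by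
      rw [min_eq_right, Real.sqrt_div hp.le]
      rw [Real.sqrt_le_one, div_le_one hνb.1]
      linarith
    have hsp : √η ≤ 2 * √p := by
      rw [show (2 : ℝ) = √4 by rw [show (4 : ℝ) = 2 ^ 2 by norm_num]; simp,
        ← Real.sqrt_mul (by norm_num)]
      exact Real.sqrt_le_sqrt (by linarith)
    refine h.trans ?_
    rw [hmin]
    calc 16 * 2 ^ 2 * (c * β t) * (η / √(γ b))
        = 64 * (c * β t) * √η * (√η / √(γ b)) := by
          rw [← hηη, Real.sqrt_mul_self hsη.le]; ring
      _ ≤ 64 * (c * β t) * √η * (2 * √p / √(γ b)) := by gcongr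
      _ = 128 * (c * β t) * √η * (√p / √(γ b)) := by ring
      _ ≤ 512 * (c * β t) * √η * (√p / √(γ b)) := by gcongr; norm_num
  -- The pulled arm is good. Its LCB at time `t` is at most that of the recommended arm, hence at
  -- most `λ_(2η)`; together with `hucb`, the gap from `η` to `2η` is at most four widths.
  · have hmono : n ≤ numPulls pull b t := numPulls_mono pull b (by omega)
    have hNt : numPulls pull b t ≠ 0 := by omega
    have hlcb := (le_lcb hNt (habs b t hNt)).trans
      ((hrun.rec_argmax t (hs.trans hst) b).trans (lcb_le (habs (rec t) t)))
    rw [EReal.coe_le_coe_iff] at hlcb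
    have hr := paretoQuantile_anti hα (by linarith : 0 < 2 * η) hrec.le
    have hw : √(ζ ^ 2 * β t / numPulls pull b t) ≤ √(ζ ^ 2 * β t / n) := by
      have : (n : ℝ) ≤ numPulls pull b t := by exact_mod_cast hmono
      gcongr
    have hanti := paretoQuantile_anti hα hη (by linarith : η ≤ 2 * η)
    have h := pulls_le_of_gap_le (κ := 4) hζ hβt hn1 (by linarith : 0 < 2 * η) hη hc
      (sub_nonneg.2 hanti) (by linarith)
      (pareto_gap_sq_lower hα hη le_rfl (by linarith) hc hcη)
    -- Indeed `γ b < 2η ≤ 4p`.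
    have hmin : 1 / 2 ≤ min 1 √(p / γ b) := by
      refine le_min (by norm_num) (Real.le_sqrt_of_sq_le ?_)
      rw [le_div_iff₀ hνb.1]
      linarith
    have hs2η : √η ≤ √(2 * η) := Real.sqrt_le_sqrt (by linarith)
    have hdiv : η / √(2 * η) ≤ √η := by
      rw [div_le_iff₀ (hsη.trans_le hs2η)]
      nlinarith
    calc (n : ℝ) ≤ 16 * 4 ^ 2 * (c * β t) * (η / √(2 * η)) := h
      _ ≤ 16 * 4 ^ 2 * (c * β t) * √η := by gcongr
      _ = 512 * (c * β t) * √η * (1 / 2) := by ring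
      _ ≤ _ := by gcongr

/-- The number of times at which the scope is of order `K` and contains an arm of rank at most
`p ≤ η`, if the recommended arm has rank larger than `2η`. -/
theorem card_times_le_of_rec_rank_gt {α η p c : ℝ} {t a K : ℕ} {T : Finset ℕ} (hα : 0 < α)
    (hζ : 0 < ζ)
    (hβ0 : ∀ s : ℕ, 1 ≤ s → 0 ≤ β s) (hβ : ∀ s t : ℕ, 1 ≤ s → s ≤ t → β s ≤ β t)
    (hnoise : ∀ a N : ℕ, 1 ≤ N →
      |∑ s ∈ Finset.range N, ε a (s + 1)| ≤ √(ζ ^ 2 * β (a + N) * N))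
    (hu : ∀ t ≥ 1, u t ≤ 1) (hγ : ∀ a, γ a ∈ Ioc (0 : ℝ) 1)
    (hrun : IsOSERun ζ β (reward (paretoQuantile α) γ ε) u pull rec)
    (hη2 : η < 1 / 2) (hc : 0 < c)
    (hcη : ζ ^ 2 ≤ c * η * (paretoQuantile α η - 1) ^ 2)
    (hp : 0 < p) (hpη : p ≤ η) (hηp : η ≤ 2 * p) (hrec : 2 * η < γ (rec t))
    (haK : a < K) (ha : γ a ≤ p) (ht : 1 ≤ t)
    (hF : ∑ b ∈ Finset.range (2 * K), min 1 √(p / γ b) ≤ 9 * K * √p)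
    (hT : ∀ s ∈ T, 1 ≤ s ∧ s ≤ t ∧ K ≤ scope s (u s) ∧ scope s (u s) ≤ 2 * K) :
    (T.card : ℝ) ≤ 2 * K + 4608 * (c * β t) * (K * η) := by
  have hη : 0 < η := hp.trans_le hpη
  have hβt : 0 ≤ β t := hβ0 t ht
  have h := card_le_of_pull_bound (pull := pull) (T := T) (fun s hs => (hT s hs).1) (n := 2 * K)
    (fun s hs => (hrun.pull_mem_scope s (hT s hs).1).trans_le (hT s hs).2.2.2)
    (M := fun b => 512 * (c * β t) * √η * min 1 √(p / γ b)) (fun b => by positivity)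
    (fun s hs => numPulls_le_of_rec_rank_gt hα hζ hβ0 hβ hnoise hu hγ hrun hη2 hc hcη hp hpη hηp
      hrec ha (hT s hs).1 (hT s hs).2.1 (haK.trans_le (hT s hs).2.2.1))
  rw [← Finset.mul_sum] at h
  refine h.trans ?_
  have hsp : √p ≤ √η := Real.sqrt_le_sqrt hpη
  have : 512 * (c * β t) * √η * ∑ b ∈ Finset.range (2 * K), min 1 √(p / γ b)
      ≤ 4608 * (c * β t) * (K * η) := by
    calc _ ≤ 512 * (c * β t) * √η * (9 * K * √η) := by
          gcongr
          exact hF.trans (by gcongr)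
      _ = 4608 * (c * β t) * (K * (√η * √η)) := by ring
      _ = _ := by rw [Real.mul_self_sqrt hη.le]
  push_cast
  linarith

end Run

/-! ### The logarithmic term `log (5t / δ)` -/

section LogTerm

variable {δ : ℝ} {t : ℕ}

theorem one_le_log_term (hδ : δ ∈ Ioo (0 : ℝ) 1) (ht : 1 ≤ t) : 1 ≤ Real.log (5 * t / δ) := by
  have ht1 : (1 : ℝ) ≤ t := by exact_mod_cast ht
  rw [Real.le_log_iff_exp_le (div_pos (by linarith) hδ.1), le_div_iff₀ hδ.1]
  nlinarith [Real.exp_one_lt_d9, Real.exp_pos 1, hδ.1, hδ.2]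

theorem log_term_mono (hδ : δ ∈ Ioo (0 : ℝ) 1) {s : ℕ} (hs : 1 ≤ s) (hst : s ≤ t) :
    Real.log (5 * s / δ) ≤ Real.log (5 * t / δ) := by
  have hs1 : (1 : ℝ) ≤ s := by exact_mod_cast hs
  have hst' : (s : ℝ) ≤ t := by exact_mod_cast hst
  have := hδ.1
  refine Real.log_le_log (by positivity) (by gcongr)

theorem log_le_log_term (hδ : δ ∈ Ioo (0 : ℝ) 1) {s : ℕ} (hs : 1 ≤ s) (hst : s ≤ t) :
    Real.log s ≤ Real.log (5 * t / δ) := by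
  have hs1 : (1 : ℝ) ≤ s := by exact_mod_cast hs
  have hst' : (s : ℝ) ≤ t := by exact_mod_cast hst
  refine Real.log_le_log (by linarith) ?_
  rw [le_div_iff₀ hδ.1]
  nlinarith [hδ.1, hδ.2]

/-- The cubic decay in `t` is what makes the failure probabilities summable over pairs. -/
theorem exp_neg_three_mul_log_term (hδ : δ ∈ Ioo (0 : ℝ) 1) (ht : 1 ≤ t) :
    Real.exp (-(3 * Real.log (5 * t / δ))) = δ ^ 3 / 125 / (t : ℝ) ^ 3 := by
  have ht1 : (1 : ℝ) ≤ t := by exact_mod_cast ht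
  have := hδ.1
  have e : 3 * Real.log (5 * t / δ) = (3 : ℕ) * Real.log (5 * t / δ) := by norm_num
  rw [Real.exp_neg, e, Real.exp_nat_mul, Real.exp_log (by positivity)]
  field_simp
  norm_num

end LogTerm

/-! ### Probabilities of the bad events -/

section Events

variable {Ω : Type*} [MeasurableSpace Ω] {μ : Measure Ω}
  {ζ : ℝ} {γ : ℕ → Ω → ℝ} {ε : ℕ → ℕ → Ω → ℝ} {U : ℕ → Ω → ℝ}

/-- Rank `0` must be discarded: `paretoQuantile` takes the default value `0` there instead of `+∞`.
-/
theorem IsBanditModel.ae_rank_mem (hmodel : IsBanditModel μ ζ γ ε U) :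
    ∀ᵐ ω ∂μ, ∀ a, γ a ω ∈ Ioc (0 : ℝ) 1 := by
  refine ae_all_iff.2 fun a => ?_
  refine ae_of_ae_map (p := fun x => x ∈ Ioc (0 : ℝ) 1) (hmodel.measurable_rank a).aemeasurable ?_
  rw [map_eq_of_isUniform (hmodel.rank_uniform a), ← Measure.restrict_congr_set Ioc_ae_eq_Icc]
  exact ae_restrict_mem measurableSet_Ioc

theorem IsBanditModel.ae_draw_le_one (hmodel : IsBanditModel μ ζ γ ε U) :
    ∀ᵐ ω ∂μ, ∀ t ≥ 1, U t ω ≤ 1 := by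
  refine ae_all_iff.2 fun t => ae_all_iff.2 fun ht => ?_
  refine ae_of_ae_map (p := fun x => x ≤ 1) (hmodel.measurable_draw t ht).aemeasurable ?_
  rw [map_eq_of_isUniform (hmodel.draw_uniform t ht)]
  filter_upwards [ae_restrict_mem measurableSet_Icc] with x hx using hx.2

variable [IsProbabilityMeasure μ]

theorem IsBanditModel.noise_large_le (hmodel : IsBanditModel μ ζ γ ε U) (hζ : 0 < ζ) (a : ℕ)
    {N : ℕ} (hN : 1 ≤ N) {x : ℝ} (hx : 0 ≤ x) :
    μ.real {ω | √(ζ ^ 2 * (6 * x) * N) ≤ |∑ s ∈ Finset.range N, ε a (s + 1) ω|}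
      ≤ 2 * Real.exp (-(3 * x)) := by
  have hN0 : (0 : ℝ) < N := by exact_mod_cast hN
  have h := measureReal_abs_sum_range_ge_le (hmodel.noise_indep a)
    (fun i => hmodel.noise_subGaussian a (i + 1) (by omega)) N
    (Real.sqrt_nonneg (ζ ^ 2 * (6 * x) * N))
  rw [Real.sq_sqrt (by positivity), Real.coe_toNNReal _ (by positivity)] at h
  refine h.trans_eq ?_
  congr 2
  field_simp
  ring

theorem IsBanditModel.all_ranks_gt_le (hmodel : IsBanditModel μ ζ γ ε U) (K : ℕ) {p : ℝ}
    (hp : 0 ≤ p) (hp1 : p ≤ 1) :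
    μ.real {ω | ∀ b < K, p < γ b ω} ≤ Real.exp (-(K * p / 2)) := by
  classical
  have hprob : ∀ b, μ.real (γ b ⁻¹' Iic p) = p := by
    intro b
    rw [measureReal_preimage_of_isUniform (hmodel.rank_uniform b) measurableSet_Iic]
    have : Icc (0 : ℝ) 1 ∩ Iic p = Icc 0 p := by
      ext x
      simp only [mem_inter_iff, mem_Icc, mem_Iic]
      constructor
      · rintro ⟨⟨h0, -⟩, h⟩; exact ⟨h0, h⟩
      · rintro ⟨h0, h⟩; exact ⟨⟨h0, h.trans hp1⟩, h⟩
    rw [this, Real.volume_real_Icc_of_le hp, sub_zero]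
  have h := measureReal_count_le_le hmodel.rank_indep hmodel.measurable_rank
    (A := fun _ => Iic p) (fun _ => measurableSet_Iic) (Finset.range K) (m := K * p)
    (by positivity) (by simp [hprob]) 0
  rw [zero_sub] at h
  refine (measureReal_mono ?_).trans h
  intro ω hω
  have he : ((Finset.range K).filter fun i => γ i ω ∈ Iic p) = ∅ :=
    Finset.filter_eq_empty_iff.2 fun b hb => not_le.2 (hω b (Finset.mem_range.1 hb))
  have : (((Finset.range K).filter fun i => γ i ω ∈ Iic p).card : ℝ) ≤ 0 := by
    rw [he, Finset.card_empty, Nat.cast_zero]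
  rw [mem_ofPred_eq]
  convert this

/-- The mean of the sum is at most `4K√p`; twice this plus the deviation `Kp ≤ K√p` gives the
constant 9. -/
theorem IsBanditModel.rank_sum_gt_le (hmodel : IsBanditModel μ ζ γ ε U) (K : ℕ) {p : ℝ}
    (hp : 0 ≤ p) (hp1 : p ≤ 1) :
    μ.real {ω | 9 * K * √p < ∑ b ∈ Finset.range (2 * K), min 1 √(p / γ b ω)}
      ≤ Real.exp (-(K * p)) := by
  have hg : Measurable fun x : ℝ => min 1 √(p / x) := by fun_prop
  have h := measureReal_sum_ge_le (f := fun b ω => min 1 √(p / γ b ω))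
    (hmodel.rank_indep.comp (fun _ x => min 1 √(p / x)) fun _ => hg)
    (fun b => hg.comp (hmodel.measurable_rank b))
    (fun b ω => ⟨le_min zero_le_one (Real.sqrt_nonneg _), min_le_left _ _⟩)
    (Finset.range (2 * K)) (m := 4 * K * √p) ?_ (K * p)
  · refine (measureReal_mono fun ω hω => ?_).trans h
    rw [mem_ofPred_eq] at hω ⊢
    refine le_trans ?_ hω.le
    have hsp : p ≤ √p := Real.le_sqrt_of_sq_le (by nlinarith)
    nlinarith [mul_le_mul_of_nonneg_left hsp (Nat.cast_nonneg (α := ℝ) K)]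
  · calc _ ≤ ∑ b ∈ Finset.range (2 * K), 2 * √p := Finset.sum_le_sum fun b _ =>
          integral_min_one_sqrt_div_le (hmodel.measurable_rank b) (hmodel.rank_uniform b) hp
      _ = 4 * K * √p := by simp; ring

/-- The draws for which the scope at time `s` is of order `K`. -/
def scopeWindow (K s : ℕ) : Set ℝ := {u | (K : ℝ) ≤ (s : ℝ) ^ u ∧ (s : ℝ) ^ u < 2 * K}

theorem measurableSet_scopeWindow (K s : ℕ) : MeasurableSet (scopeWindow K s) := by
  have h : Measurable fun u : ℝ => (s : ℝ) ^ u := measurable_const.pow measurable_id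
  exact (measurableSet_le measurable_const h).inter (measurableSet_lt h measurable_const)

theorem le_scope_of_mem_scopeWindow {K s : ℕ} {u : ℝ} (h : u ∈ scopeWindow K s) :
    K ≤ scope s u ∧ scope s u ≤ 2 * K := by
  refine ⟨Nat.le_floor h.1, Nat.floor_le_of_le ?_⟩
  push_cast
  exact h.2.le

/-- On the logarithmic scale the window is an interval of draws of length `log 2 / log s`, contained
in `[0,1]` because `2K ≤ s`. -/
theorem le_measureReal_scopeWindow {X : Ω → ℝ} (hX : pdf.IsUniform X (Icc 0 1) μ volume)
    {K s : ℕ} (hK : 1 ≤ K) (hs : 2 * K ≤ s) :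
    Real.log 2 / Real.log s ≤ μ.real (X ⁻¹' scopeWindow K s) := by
  have hK1 : (1 : ℝ) ≤ K := by exact_mod_cast hK
  have hs1 : 2 * (K : ℝ) ≤ s := by exact_mod_cast hs
  have hlog : 0 < Real.log s := Real.log_pos (by linarith)
  have hlK : 0 ≤ Real.log K := Real.log_nonneg hK1
  have hadd : Real.log (2 * K) = Real.log 2 + Real.log K :=
    Real.log_mul (by norm_num) (by linarith)
  have hle : Real.log (2 * K) ≤ Real.log s := Real.log_le_log (by linarith) hs1
  have hsub : Ico (Real.log K / Real.log s) (Real.log (2 * K) / Real.log s)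
      ⊆ Icc 0 1 ∩ scopeWindow K s := by
    rintro u ⟨h1, h2⟩
    have h0 : 0 ≤ u := (div_nonneg hlK hlog.le).trans h1
    have h3 : u ≤ 1 := h2.le.trans ((div_le_one hlog).2 hle)
    rw [div_le_iff₀ hlog] at h1
    rw [lt_div_iff₀ hlog] at h2
    refine ⟨⟨h0, h3⟩, ?_, ?_⟩
    · rw [Real.rpow_def_of_pos (by linarith), ← Real.log_le_iff_le_exp (by linarith)]
      linarith
    · rw [Real.rpow_def_of_pos (by linarith), ← Real.lt_log_iff_exp_lt (by linarith)]
      linarith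
  rw [measureReal_preimage_of_isUniform hX (measurableSet_scopeWindow K s)]
  have hfin : volume (Icc (0 : ℝ) 1 ∩ scopeWindow K s) ≠ ⊤ :=
    ((measure_mono inter_subset_left).trans_lt (by simp)).ne
  refine le_trans (le_of_eq ?_) (measureReal_mono hsub hfin)
  rw [Real.volume_real_Ico_of_le (by gcongr; linarith [Real.log_nonneg one_le_two]), hadd]
  ring

open Classical in
/-- The times `s ∈ (t / 2, t]` with scope of order `K`, shifted by one. -/
noncomputable def windowTimes (K t : ℕ) (u : ℕ → ℝ) : Finset ℕ :=
  (Finset.Ico (t / 2) t).filter fun i => u (i + 1) ∈ scopeWindow K (i + 1)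

theorem mem_windowTimes {K t : ℕ} {u : ℕ → ℝ} {i : ℕ} :
    i ∈ windowTimes K t u ↔ (t / 2 ≤ i ∧ i < t) ∧ u (i + 1) ∈ scopeWindow K (i + 1) := by
  classical
  simp [windowTimes]

theorem IsBanditModel.card_windowTimes_le_le (hmodel : IsBanditModel μ ζ γ ε U) {δ : ℝ}
    (hδ : δ ∈ Ioo (0 : ℝ) 1) {K t : ℕ} (hK : 1 ≤ K) (hKt : 4 * K ≤ t)
    (hlt : 32 * Real.log (5 * t / δ) ^ 2 ≤ t) :
    μ.real {ω | ((windowTimes K t fun s => U s ω).card : ℝ) ≤ t / (16 * Real.log (5 * t / δ))}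
      ≤ Real.exp (-(3 * Real.log (5 * t / δ))) := by
  have hl := one_le_log_term (t := t) hδ (by omega)
  set l := Real.log (5 * t / δ) with hl_def
  have ht0 : (0 : ℝ) < t := by exact_mod_cast (by omega : 0 < t)
  -- The mean is at least `(t/2)(5/8)/l`, as `5/8 < log 2`. The exponent is then `-3t/(32l)`, at
  -- most `-3l` when `t ≥ 32l²`.
  have h := measureReal_count_le_le (X := fun i => U (i + 1)) hmodel.draw_indep
    (fun i => hmodel.measurable_draw (i + 1) (by omega))
    (A := fun i => scopeWindow K (i + 1)) (fun i => measurableSet_scopeWindow K (i + 1))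
    (Finset.Ico (t / 2) t) (m := 5 * t / (16 * l)) (by positivity) ?_ (t / (16 * l))
  · refine h.trans (Real.exp_le_exp.2 ?_)
    have : t / (16 * l) - 5 * t / (16 * l) / 2 = -(3 * (t / (32 * l))) := by field_simp; ring
    rw [this, neg_le_neg_iff]
    gcongr
    rw [le_div_iff₀ (by positivity)]
    linarith
  · have hcard : (t : ℝ) / 2 ≤ (Finset.Ico (t / 2) t).card := by
      rw [Nat.card_Ico, div_le_iff₀ (by norm_num)]
      exact_mod_cast (by omega : t ≤ (t - t / 2) * 2)
    calc 5 * t / (16 * l) = t / 2 * (5 / 8 / l) := by field_simp; ring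
      _ ≤ (Finset.Ico (t / 2) t).card * (5 / 8 / l) := by gcongr
      _ = ∑ i ∈ Finset.Ico (t / 2) t, 5 / 8 / l := by simp
      _ ≤ _ := by
        refine Finset.sum_le_sum fun i hi => ?_
        rw [Finset.mem_Ico] at hi
        refine le_trans ?_ (le_measureReal_scopeWindow
          (hmodel.draw_uniform (i + 1) (by omega)) hK (by omega : 2 * K ≤ i + 1))
        have h1 := log_le_log_term hδ (by omega : 1 ≤ i + 1) (by omega : i + 1 ≤ t)
        have h2 : 0 < Real.log ((i + 1 : ℕ) : ℝ) :=
          Real.log_pos (by exact_mod_cast (by omega : 1 < i + 1))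
        have h3 := Real.log_two_gt_d9
        gcongr
        linarith

/-- The pulled and recommended arms need not be measurable, so the event is the complement of a
measurable hull of the bad set. -/
theorem exists_measurableSet_of_bad {P : Ω → Prop} {B : Set Ω} {δ : ℝ} (hδ : 0 ≤ δ)
    (hP : ∀ᵐ ω ∂μ, P ω) (hB : μ B ≤ ENNReal.ofReal δ) :
    ∃ E : Set Ω, MeasurableSet E ∧ ENNReal.ofReal (1 - δ) ≤ μ E ∧ ∀ ω ∈ E, P ω ∧ ω ∉ B := by
  refine ⟨(toMeasurable μ (B ∪ {ω | ¬ P ω}))ᶜ, (measurableSet_toMeasurable _ _).compl, ?_, ?_⟩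
  · rw [prob_compl_eq_one_sub (measurableSet_toMeasurable _ _), measure_toMeasurable,
      ENNReal.ofReal_sub _ hδ, ENNReal.ofReal_one]
    refine tsub_le_tsub_left ((measure_union_le _ _).trans ?_) _
    rw [show μ {ω | ¬ P ω} = 0 from ae_iff.1 hP, add_zero]
    exact hB
  · intro ω hω
    have h : ω ∉ B ∪ {ω | ¬ P ω} := fun h => hω (subset_toMeasurable _ _ h)
    exact ⟨by_contra fun hp => h (Or.inr hp), fun hb => h (Or.inl hb)⟩

/-- The event, of probability at least `1 - δ`, on which all concentration bounds hold. -/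
theorem IsBanditModel.exists_good_event (hmodel : IsBanditModel μ ζ γ ε U) (hζ : 0 < ζ) {δ : ℝ}
    (hδ : δ ∈ Ioo (0 : ℝ) 1) {P : Ω → Prop} (hP : ∀ᵐ ω ∂μ, P ω) :
    ∃ E : Set Ω, MeasurableSet E ∧ ENNReal.ofReal (1 - δ) ≤ μ E ∧ ∀ ω ∈ E, P ω ∧
      (∀ a N : ℕ, 1 ≤ N → |∑ s ∈ Finset.range N, ε a (s + 1) ω|
        ≤ √(ζ ^ 2 * (6 * Real.log (5 * (a + N : ℕ) / δ)) * N)) ∧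
      ∀ t k : ℕ, k < t → ∀ p : ℝ, p = 6 * Real.log (5 * t / δ) / (2 ^ k : ℕ) → p ≤ 1 →
        (∃ a < 2 ^ k, γ a ω ≤ p) ∧
        ∑ b ∈ Finset.range (2 * 2 ^ k), min 1 √(p / γ b ω) ≤ 9 * (2 ^ k : ℕ) * √p ∧
        (4 * 2 ^ k ≤ t → 32 * Real.log (5 * t / δ) ^ 2 ≤ t →
          t / (16 * Real.log (5 * t / δ)) < ((windowTimes (2 ^ k) t fun s => U s ω).card : ℝ)) := by
  set l : ℕ → ℝ := fun t => Real.log (5 * t / δ) with hl_def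
  -- One indexing serves all events: `(i, j)` stands for arm `i` with `j + 1` pulls in `B₁`, and for
  -- scope `2^i` at time `i + j + 1` in the others.
  set q : ℕ → ℕ → ℝ := fun i j => 6 * l (i + j + 1) / (2 ^ i : ℕ) with hq
  set B₁ : ℕ → ℕ → Set Ω := fun i j => {ω | √(ζ ^ 2 * (6 * l (i + j + 1)) * (j + 1 : ℕ))
    ≤ |∑ s ∈ Finset.range (j + 1), ε i (s + 1) ω|} with hB₁
  set B₂ : ℕ → ℕ → Set Ω := fun i j => {ω | q i j ≤ 1 ∧ ∀ b < 2 ^ i, q i j < γ b ω} with hB₂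
  set B₃ : ℕ → ℕ → Set Ω := fun i j => {ω | q i j ≤ 1 ∧ 9 * (2 ^ i : ℕ) * √(q i j)
    < ∑ b ∈ Finset.range (2 * 2 ^ i), min 1 √(q i j / γ b ω)} with hB₃
  set B₄ : ℕ → ℕ → Set Ω := fun i j => {ω | (4 * 2 ^ i ≤ i + j + 1 ∧
    32 * l (i + j + 1) ^ 2 ≤ (i + j + 1 : ℕ)) ∧
    ((windowTimes (2 ^ i) (i + j + 1) fun s => U s ω).card : ℝ)
      ≤ (i + j + 1 : ℕ) / (16 * l (i + j + 1))} with hB₄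
  have hdrop : ∀ (Q : Prop) (R : Ω → Prop) (x : ℝ), 0 ≤ x → (Q → μ.real {ω | R ω} ≤ x) →
      μ.real {ω | Q ∧ R ω} ≤ x := by
    intro Q R x hx h
    by_cases hQ : Q
    · simpa [hQ] using h hQ
    · simpa [hQ] using hx
  have hB : ∀ i j, μ.real (B₁ i j ∪ B₂ i j ∪ B₃ i j ∪ B₄ i j)
      ≤ δ ^ 3 / 25 / ((i + j + 1 : ℕ) : ℝ) ^ 3 := by
    intro i j
    have hm : 1 ≤ i + j + 1 := by omega
    have hl1 : 1 ≤ l (i + j + 1) := one_le_log_term hδ hm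
    have hK : (0 : ℝ) < (2 ^ i : ℕ) := by positivity
    have hKq : (2 ^ i : ℕ) * q i j = 6 * l (i + j + 1) := by
      simp only [hq]; field_simp
    have hq0 : 0 ≤ q i j := by positivity
    have h1 : μ.real (B₁ i j) ≤ 2 * Real.exp (-(3 * l (i + j + 1))) :=
      hmodel.noise_large_le hζ i (by omega) (by linarith)
    have h2 : μ.real (B₂ i j) ≤ Real.exp (-(3 * l (i + j + 1))) := by
      refine hdrop _ _ _ (Real.exp_pos _).le fun hq1 => ?_
      refine (hmodel.all_ranks_gt_le _ hq0 hq1).trans (Real.exp_le_exp.2 ?_)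
      rw [hKq]; linarith
    have h3 : μ.real (B₃ i j) ≤ Real.exp (-(3 * l (i + j + 1))) := by
      refine hdrop _ _ _ (Real.exp_pos _).le fun hq1 => ?_
      refine (hmodel.rank_sum_gt_le _ hq0 hq1).trans (Real.exp_le_exp.2 ?_)
      rw [hKq]; linarith
    have h4 : μ.real (B₄ i j) ≤ Real.exp (-(3 * l (i + j + 1))) :=
      hdrop _ _ _ (Real.exp_pos _).le fun h =>
        hmodel.card_windowTimes_le_le hδ Nat.one_le_two_pow h.1 h.2
    have he : Real.exp (-(3 * l (i + j + 1))) = δ ^ 3 / 125 / ((i + j + 1 : ℕ) : ℝ) ^ 3 :=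
      exp_neg_three_mul_log_term hδ hm
    have hu1 := measureReal_union_le (μ := μ) (B₁ i j ∪ B₂ i j ∪ B₃ i j) (B₄ i j)
    have hu2 := measureReal_union_le (μ := μ) (B₁ i j ∪ B₂ i j) (B₃ i j)
    have hu3 := measureReal_union_le (μ := μ) (B₁ i j) (B₂ i j)
    -- The noise event costs two units, being two-sided, and each of the other three costs one.
    have : δ ^ 3 / 25 / ((i + j + 1 : ℕ) : ℝ) ^ 3
        = 5 * (δ ^ 3 / 125 / ((i + j + 1 : ℕ) : ℝ) ^ 3) := by ring
    rw [this, ← he]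
    linarith
  have hδ0 := hδ.1
  have hunion := measure_iUnion_pairs_le (μ := μ) (by positivity) hB
  have hδ3 : 4 * (δ ^ 3 / 25) ≤ δ := by
    have : δ ^ 3 ≤ δ := pow_le_of_le_one hδ.1.le hδ.2.le (by norm_num)
    linarith
  obtain ⟨E, hE, hμE, hgood⟩ := exists_measurableSet_of_bad hδ.1.le hP
    (hunion.trans (ENNReal.ofReal_le_ofReal hδ3))
  refine ⟨E, hE, hμE, fun ω hω => ⟨(hgood ω hω).1, ?_, ?_⟩⟩
  · intro a N hN
    obtain ⟨j, rfl⟩ : ∃ j, N = j + 1 := ⟨N - 1, by omega⟩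
    by_contra hcon
    exact (hgood ω hω).2 (mem_iUnion₂.2 ⟨a, j, Or.inl (Or.inl (Or.inl (not_le.1 hcon).le))⟩)
  · intro t k hkt p hp hp1
    obtain ⟨j, rfl⟩ : ∃ j, t = k + j + 1 := ⟨t - k - 1, by omega⟩
    have hpq : p = q k j := hp
    rw [hpq] at hp1 ⊢
    refine ⟨?_, ?_, ?_⟩
    · by_contra! hcon
      exact (hgood ω hω).2 (mem_iUnion₂.2 ⟨k, j, Or.inl (Or.inl (Or.inr ⟨hp1, hcon⟩))⟩)
    · by_contra! hcon
      exact (hgood ω hω).2 (mem_iUnion₂.2 ⟨k, j, Or.inl (Or.inr ⟨hp1, hcon⟩)⟩)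
    · intro h4 h32
      by_contra! hcon
      exact (hgood ω hω).2 (mem_iUnion₂.2 ⟨k, j, Or.inr ⟨⟨h4, h32⟩, hcon⟩⟩)

end Events

/-! ### The rank of the recommended arm -/

theorem rec_rank_le {α ζ δ ψ η : ℝ} {t : ℕ} {γ : ℕ → ℝ} {ε : ℕ → ℕ → ℝ} {u : ℕ → ℝ}
    {pull rec : ℕ → ℕ} (hα : 0 < α) (hζ : 0 < ζ) (hδ : δ ∈ Ioo (0 : ℝ) 1) (ht : 1 ≤ t)
    (hψ : 2 ^ 30 * Real.log (5 * t / δ) ^ 3 ≤ ψ)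
    (hu : ∀ t ≥ 1, u t ≤ 1) (hγ : ∀ a, γ a ∈ Ioc (0 : ℝ) 1)
    (hrun : IsOSERun ζ (fun t => 6 * Real.log (5 * t / δ)) (reward (paretoQuantile α) γ ε) u
      pull rec)
    (hnoise : ∀ a N : ℕ, 1 ≤ N → |∑ s ∈ Finset.range N, ε a (s + 1)|
        ≤ √(ζ ^ 2 * (6 * Real.log (5 * (a + N : ℕ) / δ)) * N))
    (hgood : ∀ k : ℕ, k < t → ∀ p : ℝ, p = 6 * Real.log (5 * t / δ) / (2 ^ k : ℕ) → p ≤ 1 →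
        (∃ a < 2 ^ k, γ a ≤ p) ∧
        ∑ b ∈ Finset.range (2 * 2 ^ k), min 1 √(p / γ b) ≤ 9 * (2 ^ k : ℕ) * √p ∧
        (4 * 2 ^ k ≤ t → 32 * Real.log (5 * t / δ) ^ 2 ≤ t →
          t / (16 * Real.log (5 * t / δ)) < ((windowTimes (2 ^ k) t u).card : ℝ)))
    (hη : η ∈ Ioo (0 : ℝ) (1 / 2))
    (hS : relaxedComplexity ζ (paretoQuantile α) η ≤ ENNReal.ofReal (t / ψ)) :
    γ (rec t) ≤ 2 * η := by
  by_contra! hrec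
  have ht0 : (0 : ℝ) < t := by exact_mod_cast ht
  have hl := one_le_log_term hδ ht
  set l := Real.log (5 * t / δ) with hl_def
  have hl2 : 1 ≤ l ^ 2 := one_le_pow₀ hl
  have hl3 : 1 ≤ l ^ 3 := one_le_pow₀ hl
  have hψ0 : 0 < ψ := by linarith
  set c := t / ψ with hc_def
  have hc : 0 < c := by positivity
  have hct : c * ψ = t := div_mul_cancel₀ _ hψ0.ne'
  obtain ⟨hcη1, hcη⟩ := of_relaxedComplexity_pareto_le hα hη.1 hη.2 hc.le hS
  have hcl3 : 2 ^ 30 * (c * l ^ 3) ≤ t := by nlinarith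
  -- `K = 2^(n+1)` is the power of two with `6l < Kη ≤ 12l`, which puts `p = 6l/K` between `η/2` and
  -- `η`.
  obtain ⟨n, hn1, hn2⟩ := exists_nat_pow_near (x := 6 * l / η) (y := 2)
    (by rw [le_div_iff₀ hη.1]; linarith [hη.2]) one_lt_two
  rw [le_div_iff₀ hη.1] at hn1
  rw [div_lt_iff₀ hη.1] at hn2
  obtain ⟨K, hK⟩ : ∃ K : ℕ, K = 2 ^ (n + 1) := ⟨_, rfl⟩
  have hKr : (K : ℝ) = 2 ^ (n + 1) := by rw [hK]; push_cast; rfl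
  have hK0 : (0 : ℝ) < K := by rw [hKr]; positivity
  have hKη1 : 6 * l < K * η := by rw [hKr]; exact hn2
  have hKη2 : K * η ≤ 12 * l := by rw [hKr, pow_succ]; linarith
  have hKc : K ≤ 12 * l * c := by
    calc (K : ℝ) ≤ K * (c * η) := by nlinarith
      _ = K * η * c := by ring
      _ ≤ 12 * l * c := by gcongr
  have hlc : l * c ≤ c * l ^ 3 := by nlinarith [mul_pos hc (by linarith : 0 < l)]
  have hl2c : c * l ^ 2 ≤ c * l ^ 3 := by
    rw [pow_succ l 2]; nlinarith [mul_pos hc (by linarith : 0 < l ^ 2)]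
  have h4K : 4 * K ≤ t := by
    have : 4 * (K : ℝ) ≤ t := by linarith [mul_pos hc (by linarith : 0 < l ^ 3)]
    exact_mod_cast this
  have hc1 : 1 ≤ c := by nlinarith [hη.1, hη.2]
  have h32 : 32 * l ^ 2 ≤ t := by nlinarith
  have hkt : n + 1 < t := by
    have := Nat.lt_two_pow_self (n := n + 1)
    omega
  set p := 6 * l / K with hp_def
  have hp0 : 0 < p := by positivity
  have hpK : p * K = 6 * l := div_mul_cancel₀ _ hK0.ne'
  have hpη : p ≤ η := by rw [hp_def, div_le_iff₀ hK0]; linarith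
  have hηp : η ≤ 2 * p := by
    refine le_of_mul_le_mul_right ?_ hK0
    linarith
  obtain ⟨⟨a, haK, ha⟩, hF, hT⟩ := hgood (n + 1) hkt p (by rw [hp_def, hK])
    (by linarith [hη.2])
  rw [← hK] at haK hF hT
  have hcard := hT h4K h32
  have hβ0 : ∀ s : ℕ, 1 ≤ s → 0 ≤ 6 * Real.log (5 * s / δ) := fun s hs => by
    linarith [one_le_log_term hδ hs]
  have hbound := card_times_le_of_rec_rank_gt (c := c)
    (T := (windowTimes K t u).map (addRightEmbedding 1)) hα hζ hβ0
    (fun s r hs hsr => by linarith [log_term_mono hδ hs hsr]) hnoise hu hγ hrun hη.2 hc hcη hp0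
    hpη hηp hrec haK ha ht hF ?_
  · rw [Finset.card_map] at hbound
    -- `331800 = 2·12 + 4608·6·12`; multiplied by 16 it stays below `2^30`.
    have h1 : 2 * (K : ℝ) + 4608 * (c * (6 * l)) * (K * η) ≤ 331800 * (c * l ^ 2) := by
      have h2 : 4608 * (c * (6 * l)) * (K * η) ≤ 4608 * (c * (6 * l)) * (12 * l) := by gcongr
      nlinarith [mul_pos hc (by linarith : 0 < l)]
    have h3 : t / (16 * l) < 331800 * (c * l ^ 2) := hcard.trans_le (hbound.trans h1)
    rw [div_lt_iff₀ (by linarith)] at h3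
    have h4 : 331800 * (c * l ^ 2) * (16 * l) = 5308800 * (c * l ^ 3) := by ring
    linarith [mul_pos hc (by linarith : 0 < l ^ 3)]
  · intro s hs
    obtain ⟨i, hi, rfl⟩ := Finset.mem_map.1 hs
    rw [mem_windowTimes] at hi
    exact ⟨Nat.le_add_left 1 i, hi.1.2, le_scope_of_mem_scopeWindow hi.2⟩

end ManyArmed

theorem mainTheorem5 {Ω : Type*} [MeasurableSpace Ω] (μ : Measure Ω) [IsProbabilityMeasure μ]
    (α ζ δ : ℝ) (hα : 0 < α) (hζ : 0 < ζ) (hδ : δ ∈ Ioo (0 : ℝ) 1)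
    (ψ : ℕ → ℝ) (hψ : ∀ t : ℕ, 1 ≤ t → 2 ^ 30 * Real.log (5 * t / δ) ^ 3 ≤ ψ t)
    (γ : ℕ → Ω → ℝ) (ε : ℕ → ℕ → Ω → ℝ) (U : ℕ → Ω → ℝ)
    (hmodel : ManyArmed.IsBanditModel μ ζ γ ε U)
    (pull rec : ℕ → Ω → ℕ)
    (hrun : ∀ᵐ ω ∂μ, ManyArmed.IsOSERun ζ (fun t => 6 * Real.log (5 * t / δ))
      (ManyArmed.reward (ManyArmed.paretoQuantile α) (fun a => γ a ω) (fun a s => ε a s ω))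
      (fun t => U t ω) (fun t => pull t ω) (fun t => rec t ω)) :
    -- bounds on the rank, with the rescaled time `τ = t / (16 ψ_t)`
    (∀ t : ℕ, 1 ≤ t → ∀ τ : ℝ, τ = t / (16 * ψ t) →
      (α < 1 / 2 →
        ManyArmed.relaxedRank ζ (ManyArmed.paretoQuantile α) (ψ t) t / 2
            ≤ max (ψ t / t) ((4 * ψ t * ζ ^ 2 / (α ^ 2 * t)) ^ (1 / (1 - 2 * α))) ∧
        max (ψ t / t) ((4 * ψ t * ζ ^ 2 / (α ^ 2 * t)) ^ (1 / (1 - 2 * α)))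
            ≤ max (1 / τ) ((ζ ^ 2 / (α ^ 2 * τ)) ^ (1 / (1 - 2 * α)))) ∧
      (1 / 2 ≤ α →
        ManyArmed.relaxedRank ζ (ManyArmed.paretoQuantile α) (ψ t) t / 2
            ≤ max (ψ t / t) (if t < ψ t * (16 * ζ ^ 2) ^ (1 / (2 * α)) then 1 else 0) ∧
        max (ψ t / t) (if t < ψ t * (16 * ζ ^ 2) ^ (1 / (2 * α)) then 1 else 0)
            ≤ max (1 / τ) (if τ < (4 * ζ ^ 2) ^ (1 / (2 * α)) then 1 else 0))) ∧
    -- with probability at least `1 - δ`, simultaneously for all times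
    ∃ E : Set Ω, MeasurableSet E ∧ ENNReal.ofReal (1 - δ) ≤ μ E ∧
      ∀ ω ∈ E, ∀ t : ℕ, 1 ≤ t →
        γ (rec t ω) ω ≤ ManyArmed.relaxedRank ζ (ManyArmed.paretoQuantile α) (ψ t) t ∧
        -- bounds on the reward, with the rescaled time `τ = t / (32 ψ_t)`
        ∀ τ : ℝ, τ = t / (32 * ψ t) →
          (α < 1 / 2 →
            min (τ ^ α) ((α ^ 2 * τ / ζ ^ 2) ^ (α / (1 - 2 * α)))
              ≤ ManyArmed.paretoQuantile α (γ (rec t ω) ω)) ∧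
          (1 / 2 ≤ α →
            τ ^ α * (if (4 * ζ ^ 2) ^ (1 / (2 * α)) ≤ τ then 1 else 0)
              ≤ ManyArmed.paretoQuantile α (γ (rec t ω) ω)) := by
  have hψ0 : ∀ t : ℕ, 1 ≤ t → 0 < ψ t := fun t ht => by
    have := one_le_pow₀ (n := 3) (ManyArmed.one_le_log_term hδ ht)
    linarith [hψ t ht]
  constructor
  · intro t ht τ hτ
    have ht0 : (0 : ℝ) < t := by exact_mod_cast ht
    exact ⟨fun hα2 => ⟨ManyArmed.relaxedRank_pareto_le_of_lt hα hα2 hζ (hψ0 t ht) ht,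
      ManyArmed.max_rank_bound_le_of_lt hα hα2 (hψ0 t ht) ht0 hτ⟩,
      fun hα2 => ⟨ManyArmed.relaxedRank_pareto_le_of_ge hα2 (hψ0 t ht) ht,
      ManyArmed.max_rank_bound_le_of_ge hα2 (hψ0 t ht) ht0 hτ⟩⟩
  · obtain ⟨E, hE, hμE, hgood⟩ := hmodel.exists_good_event hζ hδ
      (hrun.and (hmodel.ae_rank_mem.and hmodel.ae_draw_le_one))
    refine ⟨E, hE, hμE, fun ω hω t ht => ?_⟩
    obtain ⟨⟨hrunω, hγ, hu⟩, hnoise, hevents⟩ := hgood ω hω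
    have hrank : γ (rec t ω) ω
        ≤ ManyArmed.relaxedRank ζ (ManyArmed.paretoQuantile α) (ψ t) t :=
      -- The good event does not depend on `η`, so every admissible `η` is treated on it at once and
      -- the infimum can be taken.
      ManyArmed.le_relaxedRank (hγ _).2 fun η hη hS =>
        ManyArmed.rec_rank_le hα hζ hδ ht (hψ t ht) hu hγ hrunω hnoise (hevents t) hη hS
    exact ⟨hrank, fun τ hτ =>
      ⟨fun hα2 => ManyArmed.pareto_reward_bound_of_lt hα hα2 hζ (hψ0 t ht) ht (hγ _).1 hrank hτ,
      fun hα2 => ManyArmed.pareto_reward_bound_of_ge hα2 (hψ0 t ht) ht (hγ _).1 hrank hτ⟩⟩
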